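/- There are an absolute constant $C>0$ and a fixed word-RAM program $P$ such that the following holds for every sequence $S[1,n]$ over the alphabet $[1,\sigma]$; let $u$ be the number of distinct values occurring in $S$. The sequence can be represented by a bit string $D$ of at most $n\log_2\sigma+Cn$ bits, such that $P$ solves range quantile queries on $S$ in time $O(\log u)$: for all $1\le i\le j\le n$ and $1\le k\le j-i+1$, the program, given read access to $D$ and the numbers $i,j,k$ (together with the parameters $n$, $\sigma$, the symbol width $\lceil\log_2\sigma\rceil$ and the word size $w$), halts after at most $C\cdot\max(1,\log_2 u)$ steps and returns the $k$-th smallest value (counted with multiplicity) in $S[i,j]$. Within the same time it also returns the number of times that this value occurs in $S[i,j]$. Here the word RAM has words of $w$ bits, for any $w$ such that a word can hold every symbol ($\sigma<2^w$) and address every bit of the structure ($n\log_2\sigma+Cn\le 2^w$); $D$ is packed into memory words, does not depend on $w$, is read-only for $P$, and loading a word, the standard arithmetic and bitwise operations on words, and comparisons take one step each. -/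

import Mathlib

namespace WordRAM

/-- The unit-cost arithmetic and bitwise instructions on `w`-bit words (unsigned, modulo `2 ^ w`).
There is no population count and no other nonstandard word operation. -/
inductive BinOp where
  | add | sub | mul | div | mod | and | or | xor | shl | shr

/-- The result of an instruction on two words. -/
def BinOp.eval {w : ℕ} : BinOp → BitVec w → BitVec w → BitVec w
  | .add, x, y => x + y
  | .sub, x, y => x - y
  | .mul, x, y => x * y
  | .div, x, y => x / y
  | .mod, x, y => x % y
  | .and, x, y => x &&& y
  | .or, x, y => x ||| y
  | .xor, x, y => x ^^^ y
  | .shl, x, y => x <<< y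
  | .shr, x, y => x >>> y

/-- The elementary right-hand sides of assignments; the numbers `r`, `r₁`, `r₂` name registers. -/
inductive Operation where
  /-- a constant written in the program -/
  | const (c : ℕ)
  /-- the content of a register -/
  | copy (r : ℕ)
  /-- an instruction applied to two registers -/
  | bin (op : BinOp) (r₁ r₂ : ℕ)
  /-- the memory word whose address is in register `r` -/
  | load (r : ℕ)

/-- Unsigned comparisons of two registers. -/
inductive Test where
  | lt (r₁ r₂ : ℕ)
  | eq (r₁ r₂ : ℕ)

/-- Structured word-RAM programs. A program is a finite object, mentions finitely many registers
and does not depend on the word size or on the input. The memory, which holds the data structure,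
is read-only; the registers are the only working storage. -/
inductive Program where
  | skip
  | assign (r : ℕ) (e : Operation)
  | seq (p q : Program)
  | ite (b : Test) (p q : Program)
  | loop (b : Test) (p : Program)

/-- The contents of the registers. -/
abbrev Registers (w : ℕ) := ℕ → BitVec w

/-- The value of an elementary right-hand side. -/
def Operation.eval {w : ℕ} (mem : BitVec w → BitVec w) (s : Registers w) :
    Operation → BitVec w
  | .const c => BitVec.ofNat w c
  | .copy r => s r
  | .bin op r₁ r₂ => op.eval (s r₁) (s r₂)
  | .load r => mem (s r)

/-- The truth of a comparison. -/
def Test.Holds {w : ℕ} (s : Registers w) : Test → Prop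
  | .lt r₁ r₂ => s r₁ < s r₂
  | .eq r₁ r₂ => s r₁ = s r₂

/-- `Exec mem p s s' t`: program `p`, started with memory `mem` and registers `s`, halts with
registers `s'` after exactly `t` steps, where every executed assignment, skip and comparison
counts as one step. -/
inductive Exec {w : ℕ} (mem : BitVec w → BitVec w) :
    Program → Registers w → Registers w → ℕ → Prop
  | skip (s : Registers w) : Exec mem .skip s s 1
  | assign (r : ℕ) (e : Operation) (s : Registers w) :
      Exec mem (.assign r e) s (Function.update s r (e.eval mem s)) 1
  | seq {p q : Program} {s s' s'' : Registers w} {t t' : ℕ} :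
      Exec mem p s s' t → Exec mem q s' s'' t' → Exec mem (.seq p q) s s'' (t + t')
  | ite_true {b : Test} {p q : Program} {s s' : Registers w} {t : ℕ} :
      b.Holds s → Exec mem p s s' t → Exec mem (.ite b p q) s s' (1 + t)
  | ite_false {b : Test} {p q : Program} {s s' : Registers w} {t : ℕ} :
      ¬ b.Holds s → Exec mem q s s' t → Exec mem (.ite b p q) s s' (1 + t)
  | loop_true {b : Test} {p : Program} {s s' s'' : Registers w} {t t' : ℕ} :
      b.Holds s → Exec mem p s s' t → Exec mem (.loop b p) s' s'' t' →
        Exec mem (.loop b p) s s'' (1 + t + t')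
  | loop_false {b : Test} {p : Program} {s : Registers w} :
      ¬ b.Holds s → Exec mem (.loop b p) s s 1

/-- The memory that holds the bit string `D`: bit `t` (from the least significant one) of the word
with address `a` is bit `a * w + t` of `D`, and all bits past the end of `D` are zero. -/
def memoryOf (w : ℕ) (D : List Bool) (a : BitVec w) : BitVec w :=
  BitVec.ofFnLE fun t : Fin w => D.getD (a.toNat * w + t) false

/-- The registers that hold the numbers in `args` in registers `0, 1, 2, …`, and then zeros. -/
def inputRegisters (w : ℕ) (args : List ℕ) : Registers w :=
  fun r => BitVec.ofNat w (args.getD r 0)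

end WordRAM

/-- The range `S[i, j]` of a sequence, with positions counted from `1`. -/
def seqRange (S : List ℕ) (i j : ℕ) : List ℕ :=
  (S.take j).drop (i - 1)

/-- The `k`-th smallest value in `S[i, j]`, counted with multiplicity and from `k = 1`. -/
def rangeQuantile (S : List ℕ) (i j k : ℕ) : Option ℕ :=
  ((seqRange S i j).mergeSort (fun a b => decide (a ≤ b)))[k - 1]?

/-- The number of distinct values in a sequence. -/
def distinctValues (S : List ℕ) : ℕ :=
  S.toFinset.card

/-! Let u be the number of distinct values and L = ⌈log₂ u⌉. Every entry of S is replaced by its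
dense rank, the number of smaller distinct values, which needs only L bits. A wavelet matrix on
these ranks has L levels. Each level is the stable partition of the previous one by the next most
significant bit, so the entries of S[i, j] whose ranks share a given prefix stay contiguous and in
order. A quantile query follows one such interval: if k is below the number of zeros in it, go to
the zeros; otherwise subtract that number and go to the ones (`QuantileState.step`). After L levels
the prefix is the dense rank of the answer and the interval length is its frequency
(`quantile_of_denseRank`). Each level costs three rank operations.

The rank is turned back into a value by an Elias–Fano representation of the distinct values. The
lowest l = ⌈log₂ σ⌉ - L bits of each value minus one are stored explicitly; the r-th high part is a
one at position high + r of a bit vector of length 2^(L+1). Finding that one is a select operation,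
done by binary search with L + 1 rank operations (`ones_marks_le_iff`), so it also fits into O(log
u).

The levels take nL bits and the low parts ul ≤ nl bits, in all n log₂ σ + O(n). Hence rank support
on N ≈ nL bits may add only O(n) bits, that is O(1/log n) per bit; the usual directory with a log
log n counter per block is too large. The remedy is to recode each block of b ≈ (log n)/4 bits with
one extra bit, as a head of O(log b) bits that determines the number of ones and a tail
(`exists_code`). The heads of about b / log b blocks fit into one table index, so one lookup sums
the ones of all preceding blocks in the group, and counters are needed only per group and per
superblock. Rank is then the sum of two counters and two table entries (`exists_rankIndex`,
`run_rank`), with no population count. `sequenceLayout_size` bounds the overhead,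
`exists_represents` assembles the bit string, and `runs_query` gives correctness and time. -/

namespace RangeQuantile

/-! ### Bit fields and packed arrays -/

/-- The number whose binary digits are `f p, …, f (p + len - 1)`, least significant first. -/
def bitsNat (f : ℕ → Bool) (p len : ℕ) : ℕ :=
  Nat.ofBits fun t : Fin len => f (p + t)

theorem testBit_bitsNat (f : ℕ → Bool) (p len t : ℕ) :
    (bitsNat f p len).testBit t = (decide (t < len) && f (p + t)) := by
  unfold bitsNat
  by_cases h : t < len
  · rw [Nat.testBit_ofBits_lt _ _ h]; simp [h]
  · rw [Nat.testBit_ofBits_ge _ _ (not_lt.mp h)]; simp [h]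

theorem bitsNat_lt (f : ℕ → Bool) (p len : ℕ) : bitsNat f p len < 2 ^ len :=
  Nat.ofBits_lt_two_pow _

/-- Used to cut a single block head out of the number formed by all heads of a group. -/
theorem bitsNat_div_mod (f : ℕ → Bool) (p len a c : ℕ) (h : a + c ≤ len) :
    bitsNat f p len / 2 ^ a % 2 ^ c = bitsNat f (p + a) c := by
  apply Nat.eq_of_testBit_eq
  intro t
  rw [Nat.testBit_mod_two_pow, Nat.testBit_div_two_pow, testBit_bitsNat, testBit_bitsNat]
  by_cases ht : t < c
  · have h1 : t + a < len := by omega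
    have h2 : p + (t + a) = p + a + t := by omega
    simp [ht, h1, h2]
  · simp [ht]

/-- The field of `len` bits that starts at position `p` of a bit string. -/
def field (D : List Bool) (p len : ℕ) : ℕ :=
  bitsNat (fun t => D.getD t false) p len

/-- `cnt` numbers `f 0, f 1, …` written one after the other with `wd` bits each. -/
def packed (wd : ℕ) (f : ℕ → ℕ) (cnt : ℕ) : List Bool :=
  (List.range (cnt * wd)).map fun p => (f (p / wd)).testBit (p % wd)

@[simp] theorem length_packed (wd : ℕ) (f : ℕ → ℕ) (cnt : ℕ) :
    (packed wd f cnt).length = cnt * wd := by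
  simp [packed]

/-- The arbitrary `pre` and `post` let every array of the final bit string be read independently of
its surroundings. The reduction modulo `2 ^ wd` disappears later wherever the entries are known to
fit. -/
theorem field_packed (pre post : List Bool) (wd : ℕ) (f : ℕ → ℕ) (cnt q a : ℕ) (hq : q < cnt)
    (ha : a = pre.length) :
    field (pre ++ (packed wd f cnt ++ post)) (a + q * wd) wd = f q % 2 ^ wd := by
  subst ha
  apply Nat.eq_of_testBit_eq
  intro t
  rw [field, testBit_bitsNat, Nat.testBit_mod_two_pow]
  by_cases ht : t < wd
  · have h1 : q * wd + t < cnt * wd := by nlinarith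
    have h2 : (q * wd + t) / wd = q := by
      rw [mul_comm, Nat.mul_add_div (by omega), Nat.div_eq_of_lt ht, add_zero]
    have h3 : (q * wd + t) % wd = t := by
      rw [mul_comm, Nat.mul_add_mod, Nat.mod_eq_of_lt ht]
    simp only [ht, decide_true, Bool.true_and]
    rw [add_assoc, List.getD_append_right _ _ _ _ (by omega), Nat.add_sub_cancel_left,
      List.getD_append _ _ _ _ (by simpa using h1), List.getD_eq_getElem _ _ (by simpa using h1)]
    simp [packed, h2, h3]
  · simp [ht]

/-! ### Running times and postconditions of programs -/

open WordRAM

/-- A straight-line program. -/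
def straight : List (ℕ × Operation) → Program
  | [] => .skip
  | (r, e) :: l => .seq (.assign r e) (straight l)

/-- The effect of a straight-line program on the registers. -/
def run {w : ℕ} (mem : BitVec w → BitVec w) : List (ℕ × Operation) → Registers w → Registers w
  | [], s => s
  | (r, e) :: l, s => run mem l (Function.update s r (e.eval mem s))

theorem run_append {w : ℕ} (mem : BitVec w → BitVec w) (l₁ l₂ : List (ℕ × Operation))
    (s : Registers w) : run mem (l₁ ++ l₂) s = run mem l₂ (run mem l₁ s) := by
  induction l₁ generalizing s with
  | nil => rfl
  | cons a l ih => exact ih _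

theorem exec_straight {w : ℕ} (mem : BitVec w → BitVec w) (l : List (ℕ × Operation))
    (s : Registers w) : Exec mem (straight l) s (run mem l s) (l.length + 1) := by
  induction l generalizing s with
  | nil => exact Exec.skip s
  | cons a l ih =>
    have := Exec.seq (Exec.assign a.1 a.2 s) (ih (Function.update s a.1 (a.2.eval mem s)))
    rw [show (a :: l).length + 1 = 1 + (l.length + 1) by simp; omega]
    exact this

/-- The program halts within `T` steps, with registers that satisfy `Q`. -/
def Runs {w : ℕ} (mem : BitVec w → BitVec w) (p : Program) (s : Registers w) (T : ℕ)
    (Q : Registers w → Prop) : Prop :=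
  ∃ s' t, Exec mem p s s' t ∧ t ≤ T ∧ Q s'

section Rules
variable {w : ℕ} {mem : BitVec w → BitVec w} {s : Registers w} {Q : Registers w → Prop}

theorem Runs.mono {p : Program} {T T' : ℕ} {Q' : Registers w → Prop} (h : Runs mem p s T Q)
    (hT : T ≤ T') (hQ : ∀ s', Q s' → Q' s') : Runs mem p s T' Q' := by
  obtain ⟨s', t, he, ht, hq⟩ := h
  exact ⟨s', t, he, ht.trans hT, hQ _ hq⟩

theorem runs_straight (l : List (ℕ × Operation)) (h : Q (run mem l s)) :
    Runs mem (straight l) s (l.length + 1) Q :=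
  ⟨_, _, exec_straight mem l s, le_rfl, h⟩

theorem Runs.seq {p q : Program} {T₁ T₂ : ℕ} {Q₁ : Registers w → Prop}
    (h₁ : Runs mem p s T₁ Q₁) (h₂ : ∀ s', Q₁ s' → Runs mem q s' T₂ Q) :
    Runs mem (.seq p q) s (T₁ + T₂) Q := by
  obtain ⟨s₁, t₁, he₁, ht₁, hq₁⟩ := h₁
  obtain ⟨s₂, t₂, he₂, ht₂, hq₂⟩ := h₂ s₁ hq₁
  exact ⟨s₂, _, he₁.seq he₂, by omega, hq₂⟩

theorem Runs.ite {b : Test} {p q : Program} {T : ℕ}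
    (h₁ : b.Holds s → Runs mem p s T Q) (h₂ : ¬ b.Holds s → Runs mem q s T Q) :
    Runs mem (.ite b p q) s (1 + T) Q := by
  by_cases hb : b.Holds s
  · obtain ⟨s', t, he, ht, hq⟩ := h₁ hb
    exact ⟨s', _, Exec.ite_true hb he, by omega, hq⟩
  · obtain ⟨s', t, he, ht, hq⟩ := h₂ hb
    exact ⟨s', _, Exec.ite_false hb he, by omega, hq⟩

/-- A loop that runs `m` times, with an invariant indexed by the number of remaining rounds. -/
theorem Runs.loop {b : Test} {p : Program} {T : ℕ} (I : ℕ → Registers w → Prop)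
    (hdone : ∀ s, I 0 s → ¬ b.Holds s) (hgo : ∀ m s, I (m + 1) s → b.Holds s)
    (hbody : ∀ m s, I (m + 1) s → Runs mem p s T (I m)) (m : ℕ) (hI : I m s) :
    Runs mem (.loop b p) s (m * (T + 1) + 1) (I 0) := by
  induction m generalizing s with
  | zero => exact ⟨s, 1, Exec.loop_false (hdone _ hI), by omega, hI⟩
  | succ m ih =>
    obtain ⟨s₁, t₁, he₁, ht₁, hq₁⟩ := hbody m s hI
    obtain ⟨s₂, t₂, he₂, ht₂, hq₂⟩ := ih hq₁
    refine ⟨s₂, _, Exec.loop_true (hgo _ _ hI) he₁ he₂, ?_, hq₂⟩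
    rw [Nat.succ_mul]; omega

end Rules

/-! ### Word arithmetic on encoded natural numbers -/

section Words
variable {w : ℕ}

theorem ofNat_div {x y : ℕ} (hx : x < 2 ^ w) (hy : y < 2 ^ w) :
    BitVec.ofNat w x / BitVec.ofNat w y = BitVec.ofNat w (x / y) := by
  apply BitVec.eq_of_toNat_eq
  rw [BitVec.toNat_udiv, BitVec.toNat_ofNat, BitVec.toNat_ofNat, BitVec.toNat_ofNat,
    Nat.mod_eq_of_lt hx, Nat.mod_eq_of_lt hy,
    Nat.mod_eq_of_lt ((Nat.div_le_self _ _).trans_lt hx)]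

theorem ofNat_mod {x y : ℕ} (hx : x < 2 ^ w) (hy : y < 2 ^ w) :
    BitVec.ofNat w x % BitVec.ofNat w y = BitVec.ofNat w (x % y) := by
  apply BitVec.eq_of_toNat_eq
  rw [BitVec.toNat_umod, BitVec.toNat_ofNat, BitVec.toNat_ofNat, BitVec.toNat_ofNat,
    Nat.mod_eq_of_lt hx, Nat.mod_eq_of_lt hy,
    Nat.mod_eq_of_lt ((Nat.mod_le _ _).trans_lt hx)]

theorem ofNat_sub {x y : ℕ} (h : y ≤ x) :
    BitVec.ofNat w x - BitVec.ofNat w y = BitVec.ofNat w (x - y) := by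
  obtain ⟨z, rfl⟩ := Nat.exists_eq_add_of_le h
  rw [Nat.add_sub_cancel_left, BitVec.ofNat_add, BitVec.add_comm, BitVec.add_sub_cancel]

theorem ofNat_shl {x y : ℕ} (hy : y < 2 ^ w) :
    BitVec.ofNat w x <<< BitVec.ofNat w y = BitVec.ofNat w (x * 2 ^ y) := by
  rw [BitVec.shiftLeft_eq', BitVec.toNat_ofNat, Nat.mod_eq_of_lt hy]
  apply BitVec.eq_of_toNat_eq
  simp [Nat.shiftLeft_eq, Nat.mod_mul_mod]

theorem ofNat_shr {x y : ℕ} (hx : x < 2 ^ w) (hy : y < 2 ^ w) :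
    BitVec.ofNat w x >>> BitVec.ofNat w y = BitVec.ofNat w (x / 2 ^ y) := by
  apply BitVec.eq_of_toNat_eq
  rw [BitVec.ushiftRight_eq', BitVec.toNat_ushiftRight, BitVec.toNat_ofNat, BitVec.toNat_ofNat,
    BitVec.toNat_ofNat, Nat.mod_eq_of_lt hx, Nat.mod_eq_of_lt hy, Nat.shiftRight_eq_div_pow,
    Nat.mod_eq_of_lt ((Nat.div_le_self _ _).trans_lt hx)]

theorem ofNat_lt_ofNat {x y : ℕ} (hx : x < 2 ^ w) (hy : y < 2 ^ w) :
    BitVec.ofNat w x < BitVec.ofNat w y ↔ x < y := by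
  rw [BitVec.lt_def, BitVec.toNat_ofNat, BitVec.toNat_ofNat, Nat.mod_eq_of_lt hx,
    Nat.mod_eq_of_lt hy]

/-- Extraction of a field from two consecutive memory words. -/
theorem extract_eq (D : List Bool) {p f : ℕ} (hw : 2 ≤ w) (hp : p < 2 ^ w) (hf : f < 2 ^ w) :
    ((memoryOf w D (BitVec.ofNat w (p / w)) >>> BitVec.ofNat w (p % w)) |||
        (memoryOf w D (BitVec.ofNat w (p / w + 1)) <<<
          (BitVec.ofNat w w - BitVec.ofNat w (p % w)))) &&&
      ((BitVec.ofNat w 1 <<< BitVec.ofNat w f) - BitVec.ofNat w 1) =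
    BitVec.ofNat w (field D p f) := by
  have hw2 : w < 2 ^ w := Nat.lt_two_pow_self
  have hmod : p % w < w := Nat.mod_lt _ (by omega)
  have hdm := Nat.div_add_mod p w
  -- The address of the second word does not wrap around; this is where `2 ≤ w` is needed.
  have ha : p / w + 1 < 2 ^ w := by
    have h1 : p / w ≤ p / 2 := Nat.div_le_div_left hw (by omega)
    have h2 : 2 ^ 2 ≤ 2 ^ w := Nat.pow_le_pow_right (by norm_num) hw
    omega
  -- A width `f ≥ w` is allowed: the mask is then all ones, and the field is only claimed modulo `2
  -- ^ w`. The header is read in this way.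
  rw [ofNat_sub hmod.le, ofNat_shl hf, one_mul,
    ofNat_sub (Nat.one_le_two_pow)]
  apply BitVec.eq_of_getLsbD_eq
  intro t ht
  rw [BitVec.getLsbD_and, BitVec.getLsbD_or, BitVec.ushiftRight_eq', BitVec.shiftLeft_eq',
    BitVec.getLsbD_ushiftRight, BitVec.getLsbD_shiftLeft, BitVec.getLsbD_ofNat,
    BitVec.getLsbD_ofNat, Nat.testBit_two_pow_sub_one, field, testBit_bitsNat]
  rw [BitVec.toNat_ofNat, BitVec.toNat_ofNat, Nat.mod_eq_of_lt (hmod.trans hw2),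
    Nat.mod_eq_of_lt (lt_of_le_of_lt (Nat.sub_le _ _) hw2)]
  unfold memoryOf
  rw [BitVec.getLsbD_ofFnLE, BitVec.getLsbD_ofFnLE, BitVec.toNat_ofNat, BitVec.toNat_ofNat,
    Nat.mod_eq_of_lt ha, Nat.mod_eq_of_lt (by omega : p / w < 2 ^ w)]
  have e1 : p / w * w = p - p % w := by rw [mul_comm]; omega
  -- Bit `t` of the field lies in the first or in the second word. If `p` is a multiple of `w`, the
  -- second word is shifted out entirely and only the first case occurs.
  by_cases hc : p % w + t < w
  · have h3 : t < w - p % w := by omega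
    simp only [hc, ht, h3, dite_true, decide_true, Bool.not_true, Bool.and_false,
      Bool.or_false, Bool.true_and, Bool.false_and]
    rw [show p / w * w + (p % w + t) = p + t by omega, Bool.and_comm]
  · have h3 : ¬ t < w - p % w := by omega
    have h4 : t - (w - p % w) < w := by omega
    simp only [hc, ht, h3, h4, dite_true, dite_false, decide_true, decide_false, Bool.not_false,
      Bool.false_or, Bool.true_and]
    rw [Nat.succ_mul, show p / w * w + w + (t - (w - p % w)) = p + t by omega, Bool.and_comm]

end Words

/-! ### Reading array entries from memory -/

/-- Reads the field that starts at the position in register 10 and whose width is in register 11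
into register 12. -/
def readField : List (ℕ × Operation) :=
  [(13, .bin .div 10 6), (14, .bin .mod 10 6), (15, .load 13), (15, .bin .shr 15 14),
    (16, .const 1), (13, .bin .add 13 16), (17, .load 13), (14, .bin .sub 6 14),
    (17, .bin .shl 17 14), (12, .bin .or 15 17), (17, .bin .shl 16 11), (17, .bin .sub 17 16),
    (12, .bin .and 12 17)]

/-- Reads entry `x` of an array of fields into register 12, given the registers that hold the
position of the array, the number `x`, and the width. -/
def fetch (base idx wd : ℕ) : List (ℕ × Operation) :=
  [(10, .bin .mul idx wd), (10, .bin .add 10 base), (11, .copy wd)] ++ readField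

section Read
variable {w : ℕ} {D : List Bool} {s : Registers w}

theorem run_readField_frame {mem : BitVec w → BitVec w} {r : ℕ} (hr : r < 12 ∨ 18 ≤ r) :
    run mem readField s r = s r := by
  have h : r ≠ 12 ∧ r ≠ 13 ∧ r ≠ 14 ∧ r ≠ 15 ∧ r ≠ 16 ∧ r ≠ 17 := by omega
  simp only [readField, run, Function.update_apply, h, if_false]

theorem run_readField {p f : ℕ} (hw : 2 ≤ w) (h6 : s 6 = BitVec.ofNat w w)
    (h10 : s 10 = BitVec.ofNat w p) (h11 : s 11 = BitVec.ofNat w f) (hp : p < 2 ^ w)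
    (hf : f < 2 ^ w) :
    run (memoryOf w D) readField s 12 = BitVec.ofNat w (field D p f) := by
  rw [← extract_eq D hw hp hf, BitVec.ofNat_add, ← ofNat_div hp Nat.lt_two_pow_self,
    ← ofNat_mod hp Nat.lt_two_pow_self, ← h6, ← h10, ← h11]
  simp [readField, run, Operation.eval, BinOp.eval]

theorem run_fetch_frame {mem : BitVec w → BitVec w} {base idx wd r : ℕ}
    (hr : r < 10 ∨ 18 ≤ r) : run mem (fetch base idx wd) s r = s r := by
  rw [fetch, run_append, run_readField_frame (by omega)]
  have h : r ≠ 10 ∧ r ≠ 11 := by omega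
  simp only [run, Function.update_apply, h, if_false]

theorem run_fetch {base idx wd a x f : ℕ} (hw : 2 ≤ w) (h6 : s 6 = BitVec.ofNat w w)
    (hwd : 12 ≤ wd) (hbase : 12 ≤ base) (ha : s base = BitVec.ofNat w a)
    (hx : s idx = BitVec.ofNat w x) (hsf : s wd = BitVec.ofNat w f)
    (hp : a + x * f < 2 ^ w) (hf : f < 2 ^ w) :
    run (memoryOf w D) (fetch base idx wd) s 12 = BitVec.ofNat w (field D (a + x * f) f) := by
  rw [fetch, run_append]
  have h1 : wd ≠ 10 ∧ base ≠ 10 := by omega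
  apply run_readField hw _ _ _ hp hf
  · simp [run, h6]
  · simp [run, Operation.eval, BinOp.eval, h1, ha, hx, hsf,
      BitVec.ofNat_add, BitVec.ofNat_mul, BitVec.add_comm]
  · simp [run, Operation.eval, h1, hsf]

end Read

/-! ### The rank operation and its correctness -/

/-- The parameters of the data structure: the block length `b`, the number `T` of blocks in a
group, the number `h` of groups in a superblock, which is also the width of a block head, the width
`tw` of a block tail, the width `W` of large counters, the number `L` of levels, and the positions
of the arrays: superblock counters, group counters, heads, tails, the two tables, and the low parts
of the values. -/
structure Layout where
  (b T h tw W L aS aG aH aT a1 a2 aL : ℕ)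

/-- The numbers in the header of the data structure. -/
def Layout.fields (Λ : Layout) : List ℕ :=
  [Λ.b, Λ.T, Λ.h, Λ.tw, Λ.W, Λ.L, Λ.aS, Λ.aG, Λ.aH, Λ.aT, Λ.a1, Λ.a2, Λ.aL]

/-- The packed heads of the group that contains block `x`. -/
def groupHeads (D : List Bool) (Λ : Layout) (x : ℕ) : ℕ :=
  field D (Λ.aH + x / Λ.T * (Λ.T * Λ.h)) (Λ.T * Λ.h)

/-- The index of the first table for the blocks that precede block `x` in its group. -/
def groupIndex (D : List Bool) (Λ : Layout) (x : ℕ) : ℕ :=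
  groupHeads D Λ x * Λ.T + x % Λ.T

/-- The code of block `x`. -/
def blockCode (D : List Bool) (Λ : Layout) (x : ℕ) : ℕ :=
  field D (Λ.aT + x * Λ.tw) Λ.tw * 2 ^ Λ.h + field D (Λ.aH + x * Λ.h) Λ.h

/-- The index of the second table for position `p`. -/
def blockIndex (D : List Bool) (Λ : Layout) (p : ℕ) : ℕ :=
  blockCode D Λ (p / Λ.b) * Λ.b + p % Λ.b

/-- The bit string `D` supports the counting function `R` up to `N`, and all positions that are
needed for it are below `M`. -/
structure IsRankIndex (D : List Bool) (Λ : Layout) (N M : ℕ) (R : ℕ → ℕ) : Prop where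
  b_lt : Λ.b < M
  T_lt : Λ.T < M
  h_lt : Λ.h + Λ.h < M
  tw_lt : Λ.tw < M
  W_lt : Λ.W < M
  Th_lt : Λ.T * Λ.h < M
  N_lt : N < M
  sup_lt : ∀ p ≤ N, Λ.aS + p / Λ.b / Λ.T / Λ.h * Λ.W < M
  grp_lt : ∀ p ≤ N, Λ.aG + p / Λ.b / Λ.T * (Λ.h + Λ.h) < M
  heads_lt : ∀ p ≤ N, Λ.aH + p / Λ.b / Λ.T * (Λ.T * Λ.h) < M
  head_lt : ∀ p ≤ N, Λ.aH + p / Λ.b * Λ.h < M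
  tail_lt : ∀ p ≤ N, Λ.aT + p / Λ.b * Λ.tw < M
  table1_lt : ∀ p ≤ N, Λ.a1 + groupIndex D Λ (p / Λ.b) * Λ.W < M
  table2_lt : ∀ p ≤ N, Λ.a2 + blockIndex D Λ p * Λ.W < M
  rank_eq : ∀ p ≤ N, R p =
    field D (Λ.aS + p / Λ.b / Λ.T / Λ.h * Λ.W) Λ.W +
    field D (Λ.aG + p / Λ.b / Λ.T * (Λ.h + Λ.h)) (Λ.h + Λ.h) +
    field D (Λ.a1 + groupIndex D Λ (p / Λ.b) * Λ.W) Λ.W +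
    field D (Λ.a2 + blockIndex D Λ p * Λ.W) Λ.W

/-- The parameters are in registers `30, …, 42`. -/
def Loaded {w : ℕ} (Λ : Layout) (s : Registers w) : Prop :=
  ∀ i < 13, s (30 + i) = BitVec.ofNat w (Λ.fields.getD i 0)

/-- Registers 22 to 26 receive the block, the offset in it, its group, its place in the group and
the superblock; 27 and 28 receive the widths of a group counter and of all heads of a group. -/
def rankBlocks : List (ℕ × Operation) :=
  [(22, .bin .div 20 30), (23, .bin .mod 20 30), (24, .bin .div 22 31), (25, .bin .mod 22 31),
    (26, .bin .div 24 32), (27, .bin .add 32 32), (28, .bin .mul 31 32)]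

/-- Puts the number of ones before the position in register 20 into register 21. -/
def rank : List (ℕ × Operation) :=
  rankBlocks ++ fetch 36 26 34 ++ [(21, .copy 12)] ++
  fetch 37 24 27 ++ [(21, .bin .add 21 12)] ++
  fetch 38 24 28 ++ [(26, .bin .mul 12 31), (26, .bin .add 26 25)] ++
  fetch 40 26 34 ++ [(21, .bin .add 21 12)] ++
  fetch 39 22 33 ++ [(26, .bin .shl 12 32)] ++
  fetch 38 22 32 ++ [(26, .bin .add 26 12), (26, .bin .mul 26 30), (26, .bin .add 26 23)] ++
  fetch 41 26 34 ++ [(21, .bin .add 21 12)]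

theorem run_single {w : ℕ} (mem : BitVec w → BitVec w) (r : ℕ) (e : Operation)
    (s : Registers w) : run mem [(r, e)] s = Function.update s r (e.eval mem s) := rfl

theorem update_register {w : ℕ} (s : Registers w) (r : ℕ) (v : BitVec w) :
    Function.update s r v r = v := Function.update_self ..

theorem run_rank_frame {w : ℕ} {mem : BitVec w → BitVec w} {s : Registers w} {r : ℕ}
    (hr : r < 10 ∨ 30 ≤ r) : run mem rank s r = s r := by
  have h : r ≠ 21 ∧ r ≠ 22 ∧ r ≠ 23 ∧ r ≠ 24 ∧ r ≠ 25 ∧ r ≠ 26 ∧ r ≠ 27 ∧ r ≠ 28 := by omega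
  have hf : ∀ (s : Registers w) (x y z : ℕ), run mem (fetch x y z) s r = s r := fun s x y z =>
    run_fetch_frame (by omega)
  have h1 : ∀ (s : Registers w) (e : Operation),
      run mem [(21, e)] s r = s r := fun s e => by simp [run_single, h]
  have h2 : ∀ (s : Registers w) (e : Operation) (l),
      run mem ((26, e) :: l) s r = run mem l (Function.update s 26 (e.eval mem s)) r :=
    fun s e l => rfl
  have h3 : ∀ (s : Registers w), run mem [] s r = s r := fun s => rfl
  have h4 : ∀ (s : Registers w), run mem rankBlocks s r = s r := fun s => by
    simp [rankBlocks, run, h]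
  simp only [rank, run_append, hf, h1, h2, h3, h4, Function.update_apply, h, if_false]

/-- The four summands of `IsRankIndex.rank_eq` are fetched one after the other and accumulated in
register 21. All positions are below `M ≤ 2 ^ w`, so no address is reduced modulo `2 ^ w`. -/
theorem run_rank {w : ℕ} {D : List Bool} {s : Registers w} {Λ : Layout} {N M p : ℕ}
    {R : ℕ → ℕ} (hw : 2 ≤ w) (h6 : s 6 = BitVec.ofNat w w) (hΛ : Loaded Λ s)
    (hD : IsRankIndex D Λ N M R) (hM : M ≤ 2 ^ w) (hp : p ≤ N) (h20 : s 20 = BitVec.ofNat w p) :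
    run (memoryOf w D) rank s 21 = BitVec.ofNat w (R p) := by
  have lt : ∀ {x : ℕ}, x < M → x < 2 ^ w := fun h => h.trans_le hM
  have lp : p < 2 ^ w := lt (hp.trans_lt hD.N_lt)
  have lb : p / Λ.b < 2 ^ w := (Nat.div_le_self _ _).trans_lt lp
  have lg : p / Λ.b / Λ.T < 2 ^ w := (Nat.div_le_self _ _).trans_lt lb
  have lh : Λ.h < 2 ^ w := lt (by have := hD.h_lt; omega)
  have g0 : s 30 = BitVec.ofNat w Λ.b := hΛ 0 (by norm_num)
  have g1 : s 31 = BitVec.ofNat w Λ.T := hΛ 1 (by norm_num)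
  have g2 : s 32 = BitVec.ofNat w Λ.h := hΛ 2 (by norm_num)
  have g3 : s 33 = BitVec.ofNat w Λ.tw := hΛ 3 (by norm_num)
  have g4 : s 34 = BitVec.ofNat w Λ.W := hΛ 4 (by norm_num)
  have g6 : s 36 = BitVec.ofNat w Λ.aS := hΛ 6 (by norm_num)
  have g7 : s 37 = BitVec.ofNat w Λ.aG := hΛ 7 (by norm_num)
  have g8 : s 38 = BitVec.ofNat w Λ.aH := hΛ 8 (by norm_num)
  have g9 : s 39 = BitVec.ofNat w Λ.aT := hΛ 9 (by norm_num)
  have g10 : s 40 = BitVec.ofNat w Λ.a1 := hΛ 10 (by norm_num)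
  have g11 : s 41 = BitVec.ofNat w Λ.a2 := hΛ 11 (by norm_num)
  clear hΛ
  set mem := memoryOf w D with hmem
  -- registers that no fetch and no assignment to 21 or 26 changes
  obtain ⟨s₀, e₀⟩ : ∃ s₀, run mem rankBlocks s = s₀ := ⟨_, rfl⟩
  have k22 : s₀ 22 = BitVec.ofNat w (p / Λ.b) := by
    rw [← e₀, ← ofNat_div lp (lt hD.b_lt), ← h20, ← g0]
    simp [rankBlocks, run, Operation.eval, BinOp.eval]
  have k23 : s₀ 23 = BitVec.ofNat w (p % Λ.b) := by
    rw [← e₀, ← ofNat_mod lp (lt hD.b_lt), ← h20, ← g0]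
    simp [rankBlocks, run, Operation.eval, BinOp.eval]
  have k24 : s₀ 24 = BitVec.ofNat w (p / Λ.b / Λ.T) := by
    rw [← e₀, ← ofNat_div lb (lt hD.T_lt), ← ofNat_div lp (lt hD.b_lt), ← h20, ← g0, ← g1]
    simp [rankBlocks, run, Operation.eval, BinOp.eval]
  have k25 : s₀ 25 = BitVec.ofNat w (p / Λ.b % Λ.T) := by
    rw [← e₀, ← ofNat_mod lb (lt hD.T_lt), ← ofNat_div lp (lt hD.b_lt), ← h20, ← g0, ← g1]
    simp [rankBlocks, run, Operation.eval, BinOp.eval]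
  have k26 : s₀ 26 = BitVec.ofNat w (p / Λ.b / Λ.T / Λ.h) := by
    rw [← e₀, ← ofNat_div lg lh, ← ofNat_div lb (lt hD.T_lt), ← ofNat_div lp (lt hD.b_lt), ← h20,
      ← g0, ← g1, ← g2]
    simp [rankBlocks, run, Operation.eval, BinOp.eval]
  have k27 : s₀ 27 = BitVec.ofNat w (Λ.h + Λ.h) := by
    rw [← e₀, BitVec.ofNat_add, ← g2]
    simp [rankBlocks, run, Operation.eval, BinOp.eval]
  have k28 : s₀ 28 = BitVec.ofNat w (Λ.T * Λ.h) := by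
    rw [← e₀, BitVec.ofNat_mul, ← g1, ← g2]
    simp [rankBlocks, run, Operation.eval, BinOp.eval]
  have k : ∀ r, r < 20 ∨ 30 ≤ r → s₀ r = s r := by
    intro r hr
    have h : r ≠ 22 ∧ r ≠ 23 ∧ r ≠ 24 ∧ r ≠ 25 ∧ r ≠ 26 ∧ r ≠ 27 ∧ r ≠ 28 := by omega
    rw [← e₀]
    simp [rankBlocks, run, h]
  -- Only the word size and the registers from 22 on other than 26 must survive: 26 serves as a
  -- varying index, and 21 is the accumulator, tracked separately.
  let Keep : Registers w → Prop := fun s' => ∀ r, r = 6 ∨ (22 ≤ r ∧ r ≠ 26) → s' r = s₀ r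
  have keep_fetch : ∀ {s' : Registers w}, Keep s' → ∀ x y z, Keep (run mem (fetch x y z) s') :=
    fun hk x y z r hr => (run_fetch_frame (by omega)).trans (hk r hr)
  have keep_update : ∀ {s' : Registers w}, Keep s' → ∀ x v, x = 21 ∨ x = 26 →
      Keep (Function.update s' x v) := by
    intro s' hk x v hx r hr
    rw [Function.update_of_ne (by omega)]
    exact hk r hr
  have go : ∀ {s' : Registers w}, Keep s' → ∀ {base idx wd a x f : ℕ}, 30 ≤ base →
      22 ≤ wd → wd ≠ 26 → s₀ base = BitVec.ofNat w a → s' idx = BitVec.ofNat w x →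
      s₀ wd = BitVec.ofNat w f → a + x * f < M → f < M →
      run mem (fetch base idx wd) s' 12 = BitVec.ofNat w (field D (a + x * f) f) := by
    intro s' hk base idx wd a x f hb h1 h2 ha hx hf l1 l2
    refine run_fetch hw ?_ (by omega) (by omega) ?_ hx ?_ (lt l1) (lt l2)
    · rw [hk 6 (by simp), k 6 (by simp), h6]
    · rw [hk _ (by omega), ha]
    · rw [hk _ (by omega), hf]
  simp only [rank, run_append, e₀]
  have c0 : Keep s₀ := fun _ _ => rfl
  -- superblock counter
  have v1 := go c0 (base := 36) (idx := 26) (wd := 34) (by norm_num) (by norm_num) (by norm_num)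
    ((k 36 (by simp)).trans g6) k26 ((k 34 (by simp)).trans g4) (hD.sup_lt p hp) hD.W_lt
  have c1 := keep_fetch c0 36 26 34
  -- Each intermediate state is made opaque after its relevant registers have been recorded, which
  -- keeps the nested updates from growing.
  generalize run mem (fetch 36 26 34) s₀ = s₁ at v1 c1 ⊢
  rw [run_single mem 21 (.copy 12) s₁]
  have c2 := keep_update c1 21 (Operation.eval mem s₁ (.copy 12)) (by simp)
  have v2 := (update_register s₁ 21 (Operation.eval mem s₁ (.copy 12))).trans v1
  generalize Function.update s₁ 21 (Operation.eval mem s₁ (.copy 12)) = s₂ at v2 c2 ⊢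
  -- group counter
  have v3 := go c2 (base := 37) (idx := 24) (wd := 27) (by norm_num) (by norm_num) (by norm_num)
    ((k 37 (by simp)).trans g7) ((c2 24 (by simp)).trans k24) k27 (hD.grp_lt p hp) hD.h_lt
  have c3 := keep_fetch c2 37 24 27
  have u3 : run mem (fetch 37 24 27) s₂ 21 = s₂ 21 := run_fetch_frame (by simp)
  generalize run mem (fetch 37 24 27) s₂ = s₃ at v3 c3 u3 ⊢
  rw [run_single mem 21 (.bin .add 21 12) s₃]
  have c4 := keep_update c3 21 (Operation.eval mem s₃ (.bin .add 21 12)) (by simp)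
  have v4 := (update_register s₃ 21 (Operation.eval mem s₃ (.bin .add 21 12))).trans
    ((congrArg₂ (fun x y : BitVec w => x + y) (u3.trans v2) v3).trans (BitVec.ofNat_add _ _).symm)
  generalize Function.update s₃ 21 (Operation.eval mem s₃ (.bin .add 21 12)) = s₄ at v4 c4 ⊢
  -- heads of the group
  have v5 := go c4 (base := 38) (idx := 24) (wd := 28) (by norm_num) (by norm_num) (by norm_num)
    ((k 38 (by simp)).trans g8) ((c4 24 (by simp)).trans k24) k28 (hD.heads_lt p hp) hD.Th_lt
  have c5 := keep_fetch c4 38 24 28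
  have u5 : run mem (fetch 38 24 28) s₄ 21 = s₄ 21 := run_fetch_frame (by simp)
  generalize run mem (fetch 38 24 28) s₄ = s₅ at v5 c5 u5 ⊢
  obtain ⟨s₆, e₆⟩ : ∃ s₆, run mem [(26, .bin .mul 12 31), (26, .bin .add 26 25)] s₅ = s₆ :=
    ⟨_, rfl⟩
  have c6 : Keep s₆ := by
    rw [← e₆]
    exact keep_update (keep_update c5 _ _ (by simp)) _ _ (by simp)
  have u6 : s₆ 21 = s₅ 21 := by
    rw [← e₆]; simp [run]
  have v6 : s₆ 26 = BitVec.ofNat w (groupIndex D Λ (p / Λ.b)) := by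
    have h31 := (c5 31 (by simp)).trans ((k 31 (by simp)).trans g1)
    have h25 := (c5 25 (by simp)).trans k25
    rw [← e₆, groupIndex, BitVec.ofNat_add, BitVec.ofNat_mul, ← h25, ← h31]
    rw [groupHeads, ← v5]
    simp [run, Operation.eval, BinOp.eval]
  rw [e₆]
  clear e₆
  have v7 := go c6 (base := 40) (idx := 26) (wd := 34) (by norm_num) (by norm_num) (by norm_num)
    ((k 40 (by simp)).trans g10) v6 ((k 34 (by simp)).trans g4) (hD.table1_lt p hp) hD.W_lt
  have c7 := keep_fetch c6 40 26 34
  have u7 : run mem (fetch 40 26 34) s₆ 21 = s₆ 21 := run_fetch_frame (by simp)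
  generalize run mem (fetch 40 26 34) s₆ = s₇ at v7 c7 u7 ⊢
  rw [run_single mem 21 (.bin .add 21 12) s₇]
  have c8 := keep_update c7 21 (Operation.eval mem s₇ (.bin .add 21 12)) (by simp)
  have v8 := (update_register s₇ 21 (Operation.eval mem s₇ (.bin .add 21 12))).trans
    ((congrArg₂ (fun x y : BitVec w => x + y) (u7.trans (u6.trans (u5.trans v4))) v7).trans
      (BitVec.ofNat_add _ _).symm)
  generalize Function.update s₇ 21 (Operation.eval mem s₇ (.bin .add 21 12)) = s₈ at v8 c8 ⊢
  -- tail of the block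
  have v9 := go c8 (base := 39) (idx := 22) (wd := 33) (by norm_num) (by norm_num) (by norm_num)
    ((k 39 (by simp)).trans g9) ((c8 22 (by simp)).trans k22) ((k 33 (by simp)).trans g3)
    (hD.tail_lt p hp) hD.tw_lt
  have c9 := keep_fetch c8 39 22 33
  have u9 : run mem (fetch 39 22 33) s₈ 21 = s₈ 21 := run_fetch_frame (by simp)
  generalize run mem (fetch 39 22 33) s₈ = s₉ at v9 c9 u9 ⊢
  rw [run_single mem 26 (.bin .shl 12 32) s₉]
  have c10 := keep_update c9 26 (Operation.eval mem s₉ (.bin .shl 12 32)) (by simp)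
  have u10 : Function.update s₉ 26 (Operation.eval mem s₉ (.bin .shl 12 32)) 21 = s₉ 21 := by
    simp
  have h32 := (c9 32 (by simp)).trans ((k 32 (by simp)).trans g2)
  have v10 := (update_register s₉ 26 (Operation.eval mem s₉ (.bin .shl 12 32))).trans
    ((congrArg₂ (fun x y : BitVec w => x <<< y) v9 h32).trans (ofNat_shl lh))
  generalize Function.update s₉ 26 (Operation.eval mem s₉ (.bin .shl 12 32)) = s₁₀
    at v10 u10 c10 ⊢
  -- head of the block
  have v11 := go c10 (base := 38) (idx := 22) (wd := 32) (by norm_num) (by norm_num) (by norm_num)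
    ((k 38 (by simp)).trans g8) ((c10 22 (by simp)).trans k22) ((k 32 (by simp)).trans g2)
    (hD.head_lt p hp) (by have := hD.h_lt; omega)
  have c11 := keep_fetch c10 38 22 32
  have u11 : run mem (fetch 38 22 32) s₁₀ 21 = s₁₀ 21 := run_fetch_frame (by simp)
  have t11 : run mem (fetch 38 22 32) s₁₀ 26 = s₁₀ 26 := run_fetch_frame (by simp)
  generalize run mem (fetch 38 22 32) s₁₀ = s₁₁ at v11 c11 u11 t11 ⊢
  obtain ⟨s₁₂, e₁₂⟩ : ∃ s₁₂, run mem
      [(26, .bin .add 26 12), (26, .bin .mul 26 30), (26, .bin .add 26 23)] s₁₁ = s₁₂ := ⟨_, rfl⟩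
  have c12 : Keep s₁₂ := by
    rw [← e₁₂]
    exact keep_update (keep_update (keep_update c11 _ _ (by simp)) _ _ (by simp)) _ _ (by simp)
  have u12 : s₁₂ 21 = s₁₁ 21 := by
    rw [← e₁₂]; simp [run]
  have v12 : s₁₂ 26 = BitVec.ofNat w (blockIndex D Λ p) := by
    have h30 := (c11 30 (by simp)).trans ((k 30 (by simp)).trans g0)
    have h23 := (c11 23 (by simp)).trans k23
    rw [← e₁₂, blockIndex, blockCode, BitVec.ofNat_add, BitVec.ofNat_mul, BitVec.ofNat_add, ← h23,
      ← h30, ← v11, ← v10, ← t11]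
    simp [run, Operation.eval, BinOp.eval]
  rw [e₁₂]
  clear e₁₂
  have v13 := go c12 (base := 41) (idx := 26) (wd := 34) (by norm_num) (by norm_num) (by norm_num)
    ((k 41 (by simp)).trans g11) v12 ((k 34 (by simp)).trans g4) (hD.table2_lt p hp) hD.W_lt
  have u13 : run mem (fetch 41 26 34) s₁₂ 21 = s₁₂ 21 := run_fetch_frame (by simp)
  generalize run mem (fetch 41 26 34) s₁₂ = s₁₃ at v13 u13 ⊢
  rw [run_single, Function.update_self, hD.rank_eq p hp, BitVec.ofNat_add]
  exact congrArg₂ (· + ·) (u13.trans (u12.trans (u11.trans (u10.trans (u9.trans v8))))) v13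

/-! ### Counting ones and the head–tail code -/

/-- The number of ones among the first `p` bits. -/
def ones (B : ℕ → Bool) (p : ℕ) : ℕ := Nat.count (fun t => B t = true) p

theorem ones_le (B : ℕ → Bool) (p : ℕ) : ones B p ≤ p := Nat.count_le _

theorem ones_mono (B : ℕ → Bool) {p q : ℕ} (h : p ≤ q) : ones B p ≤ ones B q :=
  Nat.count_monotone _ h

theorem ones_add (B : ℕ → Bool) (p q : ℕ) :
    ones B (p + q) = ones B p + ones (fun t => B (p + t)) q := Nat.count_add ..

theorem ones_congr {B B' : ℕ → Bool} {p : ℕ} (h : ∀ t < p, B t = B' t) : ones B p = ones B' p := by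
  unfold ones
  induction p with
  | zero => simp
  | succ p ih => rw [Nat.count_succ, Nat.count_succ, ih fun t ht => h t (by omega), h p (by omega)]

theorem ones_testBit_bitsNat (B : ℕ → Bool) (p : ℕ) {b r : ℕ} (h : r ≤ b) :
    ones (bitsNat B p b).testBit r = ones (fun t => B (p + t)) r :=
  ones_congr fun t ht => by rw [testBit_bitsNat]; simp [show t < b by omega]

theorem ones_sub_le (B : ℕ → Bool) {p q : ℕ} (h : p ≤ q) : ones B q - ones B p ≤ q - p := by
  obtain ⟨d, rfl⟩ := Nat.exists_eq_add_of_le h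
  rw [ones_add]
  have := ones_le (fun t => B (p + t)) d
  omega

/-- The numbers below `2 ^ (h + tw)`, which are classified by a function `f ≤ b`, have a code with
a head of `h + 1` bits and a tail of `tw` bits such that the head determines the class. -/
theorem exists_code (f : ℕ → ℕ) {b h tw : ℕ} (hb : b + 1 ≤ 2 ^ h) (hf : ∀ x, f x ≤ b) :
    ∃ head tail cls dec : ℕ → ℕ, ∀ x < 2 ^ (h + tw),
      head x < 2 ^ (h + 1) ∧ tail x < 2 ^ tw ∧ cls (head x) = f x ∧
        dec (tail x * 2 ^ (h + 1) + head x) = x := by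
  classical
  let idx : ℕ → ℕ := fun x => Nat.count (fun y => f y = f x) x
  let sz : ℕ → ℕ := fun c => Nat.count (fun y => f y = c) (2 ^ (h + tw))
  -- Class `c` receives an interval of `sz c / 2 ^ tw + 1` consecutive heads, enough to number its
  -- members with tails of `tw` bits; `start c` is the first head of that interval.
  let start : ℕ → ℕ := fun c => ∑ i ∈ Finset.range c, (sz i / 2 ^ tw + 1)
  have hpos : 0 < 2 ^ tw := by positivity
  have hmono : Monotone start := fun c d hcd =>
    Finset.sum_le_sum_of_subset (Finset.range_mono hcd)
  have hsum : ∑ i ∈ Finset.range (b + 1), sz i = 2 ^ (h + tw) := by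
    have := Finset.card_eq_sum_card_fiberwise (s := Finset.range (2 ^ (h + tw)))
      (t := Finset.range (b + 1)) (f := f)
      (fun x _ => by simpa using Nat.lt_succ_of_le (hf x))
    rw [Finset.card_range] at this
    rw [this]
    exact Finset.sum_congr rfl fun i _ => Nat.count_eq_card_filter_range ..
  -- The quotients sum to at most `2 ^ h`, and rounding costs one head for each of the `b + 1 ≤ 2 ^
  -- h` classes: one extra bit in the head suffices.
  have hstart : start (b + 1) ≤ 2 ^ (h + 1) := by
    have h1 : (∑ i ∈ Finset.range (b + 1), sz i / 2 ^ tw) * 2 ^ tw ≤ 2 ^ h * 2 ^ tw := by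
      rw [← pow_add, ← hsum, Finset.sum_mul]
      exact Finset.sum_le_sum fun i _ => Nat.div_mul_le_self _ _
    have h2 := Nat.le_of_mul_le_mul_right h1 hpos
    simp only [start, Finset.sum_add_distrib, Finset.sum_const, Finset.card_range, smul_eq_mul,
      mul_one, pow_succ]
    omega
  have hidx : ∀ x < 2 ^ (h + tw), idx x < sz (f x) := fun x hx =>
    Nat.count_strict_mono (p := fun y => f y = f x) rfl hx
  let head : ℕ → ℕ := fun x => start (f x) + idx x / 2 ^ tw
  let tail : ℕ → ℕ := fun x => idx x % 2 ^ tw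
  have hhead : ∀ x < 2 ^ (h + tw), head x < start (f x + 1) := by
    intro x hx
    have := Nat.div_le_div_right (c := 2 ^ tw) (hidx x hx).le
    simp only [head, start, Finset.sum_range_succ]
    omega
  -- The head intervals of different classes are disjoint.
  have hcls : ∀ x < 2 ^ (h + tw), ∀ y < 2 ^ (h + tw), head x = head y → f x = f y := by
    intro x hx y hy hxy
    by_contra hne
    rcases Nat.lt_or_gt_of_ne hne with hlt | hlt
    · have h1 := hmono (Nat.succ_le_of_lt hlt)
      have h2 := hhead x hx
      have h3 : start (f y) ≤ head y := Nat.le_add_right _ _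
      simp only [Nat.succ_eq_add_one] at h1
      omega
    · have h1 := hmono (Nat.succ_le_of_lt hlt)
      have h2 := hhead y hy
      have h3 : start (f x) ≤ head x := Nat.le_add_right _ _
      simp only [Nat.succ_eq_add_one] at h1
      omega
  have hinj : ∀ x < 2 ^ (h + tw), ∀ y < 2 ^ (h + tw), head x = head y → tail x = tail y →
      x = y := by
    intro x hx y hy hxy ht
    have hc := hcls x hx y hy hxy
    have hd : idx x / 2 ^ tw = idx y / 2 ^ tw := by
      simp only [head, hc] at hxy
      omega
    have hi : idx x = idx y := by
      rw [← Nat.div_add_mod (idx x) (2 ^ tw), ← Nat.div_add_mod (idx y) (2 ^ tw), hd]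
      simp only [tail] at ht
      rw [ht]
    simp only [idx, hc] at hi
    exact Nat.count_injective (p := fun z => f z = f y) hc rfl hi
  have hlt : ∀ x < 2 ^ (h + tw), head x < 2 ^ (h + 1) := fun x hx =>
    (hhead x hx).trans_le ((hmono (Nat.succ_le_succ (hf x))).trans hstart)
  -- The decoders choose any preimage: `hcls` makes the class independent of the choice, and `hinj`
  -- makes the preimage of a full code unique.
  refine ⟨head, tail,
    fun c => if hc : ∃ x, x < 2 ^ (h + tw) ∧ head x = c then f hc.choose else 0,
    fun c => if hc : ∃ x, x < 2 ^ (h + tw) ∧ tail x * 2 ^ (h + 1) + head x = c then hc.choose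
      else 0, fun x hx => ⟨hlt x hx, Nat.mod_lt _ hpos, ?_, ?_⟩⟩
  · have hc : ∃ y, y < 2 ^ (h + tw) ∧ head y = head x := ⟨x, hx, rfl⟩
    simp only [dif_pos hc]
    exact hcls _ hc.choose_spec.1 _ hx hc.choose_spec.2
  · have hc : ∃ y, y < 2 ^ (h + tw) ∧
        tail y * 2 ^ (h + 1) + head y = tail x * 2 ^ (h + 1) + head x := ⟨x, hx, rfl⟩
    simp only [dif_pos hc]
    have h1 := hc.choose_spec.2
    have h2 := hlt _ hc.choose_spec.1
    have h3 := hlt x hx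
    have h4 : head hc.choose = head x := by
      have := congrArg (· % 2 ^ (h + 1)) h1
      simpa [Nat.mul_add_mod', Nat.mod_eq_of_lt h2, Nat.mod_eq_of_lt h3] using this
    have h5 : tail hc.choose = tail x := by
      rw [h4] at h1
      exact Nat.eq_of_mul_eq_mul_right (by positivity) (Nat.add_right_cancel h1)
    exact hinj _ hc.choose_spec.1 _ hx h4 h5

/-! ### Construction of the rank index -/

/-- The layout of a data structure with the given parameters and `ng` groups of blocks, whose
superblock counters start at position `a`. -/
def layout (b T h tw W L ng a : ℕ) : Layout :=
  let aG := a + (ng / h + 1) * W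
  let aH := aG + ng * (h + h)
  let aT := aH + ng * T * h
  let a1 := aT + ng * T * tw
  let a2 := a1 + 2 ^ (T * h) * T * W
  { b, T, h, tw, W, L, aS := a, aG, aH, aT, a1, a2, aL := a2 + 2 ^ (b + 1) * b * W }

theorem sum_ones_blocks (B : ℕ → Bool) (b p q : ℕ) :
    ones B (p * b) + ∑ i ∈ Finset.range q, ones (fun t => B ((p + i) * b + t)) b =
      ones B ((p + q) * b) := by
  induction q with
  | zero => simp
  | succ q ih => rw [Finset.sum_range_succ, ← add_assoc, ih, ← ones_add, ← Nat.succ_mul]; rfl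

theorem mul_add_lt_mul {x y a c : ℕ} (hx : x < a) (hy : y < c) : x * c + y < a * c :=
  calc x * c + y < (x + 1) * c := by rw [Nat.succ_mul]; omega
    _ ≤ a * c := Nat.mul_le_mul_right _ hx

-- A prefix of length `p` splits into whole superblocks, whole groups, whole blocks and a partial
-- block; each of the four arrays accounts for one piece. The hypothesis `hTb` makes a counter
-- relative to the superblock fit into `2 (h + 1)` bits. Since `B` is defined on all of `ℕ`, the
-- last group is simply filled with further bits of `B`.
set_option maxHeartbeats 1000000 in
theorem exists_rankIndex {b T h tw W N : ℕ} (hb0 : 0 < b) (hT0 : 0 < T)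
    (hb : b + 1 ≤ 2 ^ h) (hbt : b = h + tw)
    (hTb : (h + 1) * T * b < 2 ^ (h + 1 + (h + 1))) (B : ℕ → Bool) (hW : N < 2 ^ W) (L a : ℕ) :
    ∃ body : List Bool,
      a + body.length = (layout b T (h + 1) tw W L (N / b / T + 1) a).aL ∧
      ∀ (pre post : List Bool) (M : ℕ), pre.length = a →
        (pre ++ (body ++ post)).length < M → b < M → T < M → h + 1 + (h + 1) < M → W < M →
        T * (h + 1) < M → N < M →
        IsRankIndex (pre ++ (body ++ post)) (layout b T (h + 1) tw W L (N / b / T + 1) a) N M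
          (ones B) := by
  obtain ⟨head, tail, cls, dec, hcode⟩ := exists_code (fun x => ones x.testBit b) (tw := tw) hb
    (fun x => ones_le _ _)
  rw [← hbt] at hcode
  set h₁ := h + 1 with hh₁
  set ng := N / b / T + 1 with hng
  let X : ℕ → ℕ := fun x => bitsNat B (x * b) b
  have hX : ∀ x, X x < 2 ^ b := fun x => bitsNat_lt ..
  let SUP := packed W (fun u => ones B (u * h₁ * T * b)) (ng / h₁ + 1)
  let GRP := packed (h₁ + h₁) (fun g => ones B (g * T * b) - ones B (g / h₁ * h₁ * T * b)) ng
  let HEADS := packed h₁ (fun x => head (X x)) (ng * T)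
  let TAILS := packed tw (fun x => tail (X x)) (ng * T)
  -- An index of `T1` is the packed heads times `T` plus the number of blocks to be summed; an index
  -- of `T2` is a block code times `b` plus an offset.
  let T1 := packed W (fun i => ∑ q ∈ Finset.range (i % T), cls (i / T / 2 ^ (q * h₁) % 2 ^ h₁))
    (2 ^ (T * h₁) * T)
  let T2 := packed W (fun i => ones (dec (i / b)).testBit (i % b)) (2 ^ (b + 1) * b)
  refine ⟨SUP ++ GRP ++ HEADS ++ TAILS ++ T1 ++ T2, ?_, ?_⟩
  · simp only [List.length_append, SUP, GRP, HEADS, TAILS, T1, T2, length_packed, layout]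
    omega
  intro pre post M hpre hlen hbM hTM hhM hWM hThM hNM
  set D := pre ++ (SUP ++ GRP ++ HEADS ++ TAILS ++ T1 ++ T2 ++ post) with hD
  have hlenD : a + (ng / h₁ + 1) * W + ng * (h₁ + h₁) + ng * T * h₁ + ng * T * tw +
      2 ^ (T * h₁) * T * W + 2 ^ (b + 1) * b * W < M := by
    refine lt_of_le_of_lt ?_ hlen
    simp only [hD, List.length_append, SUP, GRP, HEADS, TAILS, T1, T2, length_packed, hpre]
    omega
  have pos_le : ∀ {i c wd : ℕ}, i < c → i * wd ≤ c * wd := fun hi => Nat.mul_le_mul_right _ hi.le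
  set Λ := layout b T h₁ tw W L ng a with hΛ
  have eb : Λ.b = b := rfl
  have eT : Λ.T = T := rfl
  have eh : Λ.h = h₁ := rfl
  have etw : Λ.tw = tw := rfl
  have eW : Λ.W = W := rfl
  have eS : Λ.aS = a := rfl
  have eG : Λ.aG = a + (ng / h₁ + 1) * W := rfl
  have eH : Λ.aH = Λ.aG + ng * (h₁ + h₁) := rfl
  have eTt : Λ.aT = Λ.aH + ng * T * h₁ := rfl
  have e1 : Λ.a1 = Λ.aT + ng * T * tw := rfl
  have e2 : Λ.a2 = Λ.a1 + 2 ^ (T * h₁) * T * W := rfl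
  -- the arrays
  have fS : ∀ u < ng / h₁ + 1, field D (Λ.aS + u * W) W = ones B (u * h₁ * T * b) % 2 ^ W := by
    intro u hu
    have : D = pre ++ (SUP ++ (GRP ++ HEADS ++ TAILS ++ T1 ++ T2 ++ post)) := by
      simp only [hD, List.append_assoc]
    rw [this]
    exact field_packed _ _ _ _ _ _ _ hu hpre.symm
  have fG : ∀ g < ng, field D (Λ.aG + g * (h₁ + h₁)) (h₁ + h₁) =
      (ones B (g * T * b) - ones B (g / h₁ * h₁ * T * b)) % 2 ^ (h₁ + h₁) := by
    intro g hg
    have : D = pre ++ SUP ++ (GRP ++ (HEADS ++ TAILS ++ T1 ++ T2 ++ post)) := by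
      simp only [hD, List.append_assoc]
    rw [this]
    refine field_packed _ _ _ _ _ _ _ hg ?_
    simp only [eG, List.length_append, SUP, length_packed, hpre]
  have fH : ∀ x < ng * T, field D (Λ.aH + x * h₁) h₁ = head (X x) := by
    intro x hx
    have : D = pre ++ SUP ++ GRP ++ (HEADS ++ (TAILS ++ T1 ++ T2 ++ post)) := by
      simp only [hD, List.append_assoc]
    rw [this, field_packed _ _ _ _ _ _ _ hx, Nat.mod_eq_of_lt (hcode _ (hX x)).1]
    simp only [eH, eG, List.length_append, SUP, GRP, length_packed, hpre]
  have fT : ∀ x < ng * T, field D (Λ.aT + x * tw) tw = tail (X x) := by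
    intro x hx
    have : D = pre ++ SUP ++ GRP ++ HEADS ++ (TAILS ++ (T1 ++ T2 ++ post)) := by
      simp only [hD, List.append_assoc]
    rw [this, field_packed _ _ _ _ _ _ _ hx, Nat.mod_eq_of_lt (hcode _ (hX x)).2.1]
    simp only [eTt, eH, eG, List.length_append, SUP, GRP, HEADS, length_packed, hpre]
  have f1 : ∀ i < 2 ^ (T * h₁) * T, field D (Λ.a1 + i * W) W =
      (∑ q ∈ Finset.range (i % T), cls (i / T / 2 ^ (q * h₁) % 2 ^ h₁)) % 2 ^ W := by
    intro i hi
    have : D = pre ++ SUP ++ GRP ++ HEADS ++ TAILS ++ (T1 ++ (T2 ++ post)) := by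
      simp only [hD, List.append_assoc]
    rw [this]
    refine field_packed _ _ _ _ _ _ _ hi ?_
    simp only [e1, eTt, eH, eG, List.length_append, SUP, GRP, HEADS, TAILS, length_packed, hpre]
  have f2 : ∀ i < 2 ^ (b + 1) * b, field D (Λ.a2 + i * W) W =
      ones (dec (i / b)).testBit (i % b) % 2 ^ W := by
    intro i hi
    have : D = pre ++ SUP ++ GRP ++ HEADS ++ TAILS ++ T1 ++ (T2 ++ post) := by
      simp only [hD, List.append_assoc]
    rw [this]
    refine field_packed _ _ _ _ _ _ _ hi ?_
    simp only [e2, e1, eTt, eH, eG, List.length_append, SUP, GRP, HEADS, TAILS, T1,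
      length_packed, hpre]
  -- the indices
  have ig : ∀ p ≤ N, p / b / T < ng := fun p hp =>
    Nat.lt_succ_of_le (Nat.div_le_div_right (Nat.div_le_div_right hp))
  have iu : ∀ p ≤ N, p / b / T / h₁ < ng / h₁ + 1 := fun p hp =>
    Nat.lt_succ_of_le (Nat.div_le_div_right (ig p hp).le)
  have ix : ∀ p ≤ N, p / b < ng * T := fun p hp => (Nat.div_lt_iff_lt_mul hT0).1 (ig p hp)
  have i1 : ∀ p ≤ N, groupIndex D Λ (p / b) < 2 ^ (T * h₁) * T := by
    intro p hp
    have h1 : groupHeads D Λ (p / b) < 2 ^ (T * h₁) := by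
      rw [groupHeads, field, eT, eh]
      exact bitsNat_lt ..
    have h2 : p / b % T < T := Nat.mod_lt _ hT0
    rw [groupIndex, eT]
    exact mul_add_lt_mul h1 h2
  have ecode : ∀ p ≤ N, blockCode D Λ (p / b) =
      tail (X (p / b)) * 2 ^ h₁ + head (X (p / b)) := by
    intro p hp
    rw [blockCode, eh, etw, fH _ (ix p hp), fT _ (ix p hp)]
  have i2 : ∀ p ≤ N, blockIndex D Λ p < 2 ^ (b + 1) * b := by
    intro p hp
    obtain ⟨h1, h2, -⟩ := hcode _ (hX (p / b))
    have h3 : p % b < b := Nat.mod_lt _ hb0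
    have h4 : 2 ^ (b + 1) = 2 ^ tw * 2 ^ h₁ := by rw [← pow_add]; congr 1; omega
    rw [blockIndex, eb, ecode p hp, h4]
    have h5 : tail (X (p / b)) * 2 ^ h₁ + head (X (p / b)) < 2 ^ tw * 2 ^ h₁ :=
      mul_add_lt_mul h2 h1
    exact mul_add_lt_mul h5 h3
  refine ⟨hbM, hTM, hhM, by rw [etw]; omega, hWM, hThM, hNM, ?_, ?_, ?_, ?_, ?_, ?_, ?_, ?_⟩
  · intro p hp
    have := pos_le (wd := W) (iu p hp)
    rw [eb, eT, eh, eW, eS]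
    omega
  · intro p hp
    have := pos_le (wd := h₁ + h₁) (ig p hp)
    rw [eb, eT, eh, eG]
    omega
  · intro p hp
    have := pos_le (wd := T * h₁) (ig p hp)
    rw [eb, eT, eh, eH, eG]
    rw [← mul_assoc ng] at this
    omega
  · intro p hp
    have := pos_le (wd := h₁) (ix p hp)
    rw [eb, eh, eH, eG]
    omega
  · intro p hp
    have := pos_le (wd := tw) (ix p hp)
    rw [eb, etw, eTt, eH, eG]
    omega
  · intro p hp
    have := pos_le (wd := W) (i1 p hp)
    rw [eb, eW, e1, eTt, eH, eG]
    omega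
  · intro p hp
    have := pos_le (wd := W) (i2 p hp)
    rw [eW, e2, e1, eTt, eH, eG]
    omega
  intro p hp
  have small : ∀ {v : ℕ}, v ≤ p → v % 2 ^ W = v := fun hv =>
    Nat.mod_eq_of_lt ((hv.trans hp).trans_lt hW)
  obtain ⟨x, hx⟩ : ∃ x, p / b = x := ⟨_, rfl⟩
  obtain ⟨r, hr⟩ : ∃ r, p % b = r := ⟨_, rfl⟩
  obtain ⟨g, hg⟩ : ∃ g, x / T = g := ⟨_, rfl⟩
  obtain ⟨q, hq⟩ : ∃ q, x % T = q := ⟨_, rfl⟩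
  have hpx : p = x * b + r := by rw [← hx, ← hr, mul_comm, Nat.div_add_mod]
  have hxg : x = g * T + q := by rw [← hg, ← hq, mul_comm, Nat.div_add_mod]
  have hqT : q < T := hq ▸ Nat.mod_lt _ hT0
  have hrb : r < b := hr ▸ Nat.mod_lt _ hb0
  have hxp : x * b ≤ p := by omega
  have hgp : g * T * b ≤ p := (Nat.mul_le_mul_right b (by omega : g * T ≤ x)).trans hxp
  have hgh : g / h₁ * h₁ ≤ g := Nat.div_mul_le_self _ _
  have hugp : g / h₁ * h₁ * T * b ≤ g * T * b :=
    Nat.mul_le_mul_right _ (Nat.mul_le_mul_right _ hgh)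
  have s1 := fS _ (iu p hp)
  have s2 := fG _ (ig p hp)
  have s3 := f1 _ (i1 p hp)
  have s4 := f2 _ (i2 p hp)
  have hgng := ig p hp
  have hcodex := ecode p hp
  rw [hx, hg] at s1 s2 hgng
  rw [hx] at s3 hcodex
  rw [small ((ones_le _ _).trans (hugp.trans hgp))] at s1
  -- A group starts less than `h₁` groups after its superblock, so the difference is at most the
  -- length `h₁ * T * b` of a superblock.
  have d2 : ones B (g * T * b) - ones B (g / h₁ * h₁ * T * b) < 2 ^ (h₁ + h₁) := by
    refine lt_of_le_of_lt ((ones_sub_le B hugp).trans ?_) hTb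
    rw [Nat.sub_le_iff_le_add, ← add_mul, ← add_mul]
    refine Nat.mul_le_mul_right _ (Nat.mul_le_mul_right _ ?_)
    have h1 := Nat.div_add_mod g h₁
    have h2 := Nat.mod_lt g (show 0 < h₁ by omega)
    rw [mul_comm (g / h₁)]
    omega
  rw [Nat.mod_eq_of_lt d2] at s2
  -- The heads of a group are adjacent in memory, so chunk `i` of the long field is the head of
  -- block `g * T + i`, and its class is the number of ones in that block.
  have d3 : ∑ i ∈ Finset.range q, cls (groupHeads D Λ x / 2 ^ (i * h₁) % 2 ^ h₁) =
      ∑ i ∈ Finset.range q, ones (fun t => B ((g * T + i) * b + t)) b := by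
    refine Finset.sum_congr rfl fun i hi => ?_
    have hi' : i < T := (Finset.mem_range.1 hi).trans hqT
    have h1 : i * h₁ + h₁ ≤ T * h₁ := by
      rw [← Nat.succ_mul]
      exact Nat.mul_le_mul_right _ hi'
    have h2 : g * T + i < ng * T := mul_add_lt_mul hgng hi'
    have h3 : field D (Λ.aH + (g * T + i) * h₁) h₁ = head (X (g * T + i)) := fH _ h2
    rw [groupHeads, field, eT, eh, hg, bitsNat_div_mod _ _ _ _ _ h1]
    have h4 : Λ.aH + g * (T * h₁) + i * h₁ = Λ.aH + (g * T + i) * h₁ := by ring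
    rw [field] at h3
    rw [h4, h3, (hcode _ (hX _)).2.2.1]
    exact ones_testBit_bitsNat B _ le_rfl
  have e3 : groupIndex D Λ x / T = groupHeads D Λ x := by
    rw [groupIndex, eT, mul_comm, Nat.mul_add_div hT0, hq, Nat.div_eq_of_lt hqT, add_zero]
  have e3' : groupIndex D Λ x % T = q := by
    rw [groupIndex, eT, hq, Nat.mul_add_mod', Nat.mod_eq_of_lt hqT]
  have hsum := sum_ones_blocks B b (g * T) q
  rw [← hxg] at hsum
  rw [e3, e3', d3, small (by have := ones_le B (x * b); omega)] at s3
  have e4 : blockIndex D Λ p / b = blockCode D Λ x := by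
    rw [blockIndex, eb, mul_comm, Nat.mul_add_div hb0, hr, Nat.div_eq_of_lt hrb, add_zero, hx]
  have e4' : blockIndex D Λ p % b = r := by
    rw [blockIndex, eb, hr, Nat.mul_add_mod', Nat.mod_eq_of_lt hrb]
  have d4 : ones (dec (blockCode D Λ x)).testBit r = ones (fun t => B (x * b + t)) r := by
    rw [hcodex, (hcode _ (hX x)).2.2.2]
    exact ones_testBit_bitsNat B _ hrb.le
  have hlast := ones_add B (x * b) r
  rw [← hpx] at hlast
  rw [e4, e4', d4, small (by have := ones_le B p; omega)] at s4
  rw [eb, eT, eh, eW, hx, hg, s1, s2, s3, s4]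
  have hm := ones_mono B hugp
  omega

/-! ### Stable partitions and the wavelet matrix -/

/-- The entries of a list with indices in `[lo, hi)`. -/
def segment (l : List ℕ) (lo hi : ℕ) : List ℕ := (l.take hi).drop lo

theorem take_filter_append (p : ℕ → Bool) (l l' : List ℕ) (i : ℕ) :
    (l.filter p ++ l').take ((l.take i).countP p) = (l.take i).filter p := by
  conv_lhs => enter [2]; rw [← List.take_append_drop i l]
  rw [List.filter_append, List.append_assoc, List.countP_eq_length_filter, List.take_left]

theorem drop_filter (p : ℕ → Bool) (l : List ℕ) (i : ℕ) :
    (l.filter p).drop ((l.take i).countP p) = (l.drop i).filter p := by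
  conv_lhs => enter [2]; rw [← List.take_append_drop i l]
  rw [List.filter_append, List.countP_eq_length_filter, List.drop_left]

/-- Filtering keeps the order, so the survivors of a range are contiguous, and their end positions
are the numbers of survivors before the old ends. This is the rule for mapping an interval to the
zeros of the next level. -/
theorem segment_filter_append (p : ℕ → Bool) (l l' : List ℕ) {lo hi : ℕ} (h : lo ≤ hi) :
    segment (l.filter p ++ l') ((l.take lo).countP p) ((l.take hi).countP p) =
      (segment l lo hi).filter p := by
  rw [segment, take_filter_append, segment, ← drop_filter, List.take_take, min_eq_left h]

/-- The same rule for the ones, which are displaced by the number of zeros of the level. -/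
theorem segment_append_filter (p : ℕ → Bool) (l' l : List ℕ) {lo hi : ℕ} (h : lo ≤ hi) :
    segment (l' ++ l.filter p) (l'.length + (l.take lo).countP p)
      (l'.length + (l.take hi).countP p) = (segment l lo hi).filter p := by
  have := segment_filter_append p l [] h
  rw [List.append_nil] at this
  rw [← this, segment, List.take_length_add_append, List.drop_length_add_append, segment]

/-- The stable partition of a list by bit `m`. -/
def splitBit (m : ℕ) (l : List ℕ) : List ℕ :=
  l.filter (fun x => !x.testBit m) ++ l.filter (fun x => x.testBit m)

theorem length_filter_not (p : ℕ → Bool) (l : List ℕ) :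
    (l.filter fun x => !p x).length + l.countP p = l.length := by
  rw [← List.countP_eq_length_filter, l.length_eq_countP_add_countP p, add_comm]
  congr 2
  ext x
  simp

@[simp] theorem length_splitBit (m : ℕ) (l : List ℕ) : (splitBit m l).length = l.length := by
  rw [splitBit, List.length_append, ← List.countP_eq_length_filter (l := l) (p := (·.testBit m))]
  exact length_filter_not _ l

/-- Level `t` of the wavelet matrix of a list of numbers with `L` bits. -/
def level (X : List ℕ) (L : ℕ) : ℕ → List ℕ
  | 0 => X
  | t + 1 => splitBit (L - 1 - t) (level X L t)

@[simp] theorem length_level (X : List ℕ) (L t : ℕ) : (level X L t).length = X.length := by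
  induction t with
  | zero => rfl
  | succ t ih => rw [level, length_splitBit, ih]

/-- The bits of all levels of the wavelet matrix, followed by the bits `H`. -/
def structureBits (X : List ℕ) (L : ℕ) (H : ℕ → Bool) (p : ℕ) : Bool :=
  if p < X.length * L then
    ((level X L (p / X.length)).getD (p % X.length) 0).testBit (L - 1 - p / X.length)
  else H (p - X.length * L)

theorem ones_getD_testBit (l : List ℕ) (m i : ℕ) (hi : i ≤ l.length) :
    ones (fun t => (l.getD t 0).testBit m) i = (l.take i).countP (·.testBit m) := by
  induction i with
  | zero => simp [ones]
  | succ i ih =>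
    have := ih (by omega)
    unfold ones at this ⊢
    rw [Nat.count_succ, this, List.take_add_one, List.countP_append,
      List.getElem?_eq_getElem (by omega)]
    beta_reduce
    rw [List.getD_eq_getElem _ _ (by omega)]
    simp [List.countP_cons]

/-- All levels share one rank index, so a count within a level is a difference of two global ranks.
The case `i = X.length` is included: it yields the total of this level and the offset of the next
one from a single rank. -/
theorem ones_level (X : List ℕ) (L : ℕ) (H : ℕ → Bool) {t i : ℕ} (ht : t < L)
    (hi : i ≤ X.length) :
    ones (structureBits X L H) (t * X.length + i) = ones (structureBits X L H) (t * X.length) +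
      ((level X L t).take i).countP (·.testBit (L - 1 - t)) := by
  rw [ones_add, ← ones_getD_testBit _ _ _ (by simpa using hi)]
  congr 1
  refine ones_congr fun s hs => ?_
  have hs' : s < X.length := by omega
  have h1 : t * X.length + s < X.length * L := by
    rw [mul_comm X.length]; exact mul_add_lt_mul ht hs'
  have h2 : (t * X.length + s) / X.length = t := by
    rw [mul_comm, Nat.mul_add_div (by omega), Nat.div_eq_of_lt hs', add_zero]
  have h3 : (t * X.length + s) % X.length = s := by
    rw [Nat.mul_add_mod', Nat.mod_eq_of_lt hs']
  simp only [structureBits, h1, if_true, h2, h3]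

theorem ones_after_levels (X : List ℕ) (L : ℕ) (H : ℕ → Bool) (p : ℕ) :
    ones (structureBits X L H) (X.length * L + p) =
      ones (structureBits X L H) (X.length * L) + ones H p := by
  rw [ones_add]
  congr 1
  refine ones_congr fun s _ => ?_
  simp [structureBits]

/-- The state of a quantile query for the list `M` and the (zero-based) rank `k₀` at level `t` of
the wavelet matrix. -/
structure QuantileState (X : List ℕ) (L : ℕ) (M : List ℕ) (k₀ t lo hi k r : ℕ) : Prop where
  le : lo ≤ hi
  le_length : hi ≤ X.length
  lt : k < hi - lo
  segment_eq : segment (level X L t) lo hi = M.filter fun x => x / 2 ^ (L - t) = r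
  rank_eq : k₀ = (M.countP fun x => x < r * 2 ^ (L - t)) + k

theorem length_segment (l : List ℕ) {lo hi : ℕ} (h : hi ≤ l.length) :
    (segment l lo hi).length = hi - lo := by
  rw [segment, List.length_drop, List.length_take, min_eq_left h]

theorem countP_take_mono (p : ℕ → Bool) (l : List ℕ) {i j : ℕ} (h : i ≤ j) :
    (l.take i).countP p ≤ (l.take j).countP p :=
  (List.take_prefix_take_left h).sublist.countP_le

/-- Extending the prefix `r` by the bit `β` selects exactly the numbers with prefix `r` and bit `m`
equal to `β`. -/
theorem div_two_pow_eq_iff (x m r : ℕ) (β : Bool) :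
    x / 2 ^ m = 2 * r + β.toNat ↔ x / 2 ^ (m + 1) = r ∧ x.testBit m = β := by
  have h1 : x / 2 ^ (m + 1) = x / 2 ^ m / 2 := by rw [pow_succ, Nat.div_div_eq_div_mul]
  rw [h1, Nat.testBit_eq_decide_div_mod_eq]
  cases β
  · simp only [Bool.toNat_false, decide_eq_false_iff_not]; omega
  · simp only [Bool.toNat_true, decide_eq_true_iff]; omega

/-- `hi - ohi - (lo - olo)` is the number of zeros in the current interval. If `k` is below it, the
answer has prefix `2 * r`; otherwise these elements are all smaller than the answer and move from
`k` into the count of smaller elements. The inequalities in front ensure that the subtractions made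
by the program do not underflow. -/
theorem QuantileState.step {X : List ℕ} {L : ℕ} {M : List ℕ} {k₀ t lo hi k r : ℕ}
    (hs : QuantileState X L M k₀ t lo hi k r) (ht : t < L) {olo ohi o : ℕ}
    (hlo : olo = ((level X L t).take lo).countP (·.testBit (L - 1 - t)))
    (hhi : ohi = ((level X L t).take hi).countP (·.testBit (L - 1 - t)))
    (ho : o = ((level X L t).take X.length).countP (·.testBit (L - 1 - t))) :
    olo ≤ lo ∧ ohi ≤ hi ∧ lo - olo ≤ hi - ohi ∧ o ≤ X.length ∧
    (k < hi - ohi - (lo - olo) →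
      QuantileState X L M k₀ (t + 1) (lo - olo) (hi - ohi) k (2 * r)) ∧
    (¬ k < hi - ohi - (lo - olo) →
      QuantileState X L M k₀ (t + 1) (X.length - o + olo) (X.length - o + ohi)
        (k - (hi - ohi - (lo - olo))) (2 * r + 1)) := by
  obtain ⟨h1, h2, h3, h4, h5⟩ := hs
  obtain ⟨m, hm⟩ : ∃ m, L - 1 - t = m := ⟨_, rfl⟩
  have hLt : L - t = m + 1 := by omega
  have hLt' : L - (t + 1) = m := by omega
  rw [hm] at hlo hhi ho
  rw [hLt] at h4 h5
  have hl : (level X L t).length = X.length := length_level X L t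
  have hnext : level X L (t + 1) = splitBit m (level X L t) := by rw [level, hm]
  obtain ⟨l, hle⟩ : ∃ l, level X L t = l := ⟨_, rfl⟩
  rw [hle] at hlo hhi ho h4 hl hnext
  have zeros : ∀ i ≤ X.length,
      (l.take i).countP (fun x => !x.testBit m) + (l.take i).countP (·.testBit m) = i := by
    intro i hi
    have := length_filter_not (·.testBit m) (l.take i)
    rw [← List.countP_eq_length_filter, List.length_take, hl, min_eq_left hi] at this
    exact this
  have z1 := zeros lo (h1.trans h2)
  have z2 := zeros hi h2
  have z3 := zeros X.length le_rfl
  have mono := countP_take_mono (·.testBit m) l h1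
  have mono' := countP_take_mono (fun x => !x.testBit m) l h1
  have mono2 := countP_take_mono (·.testBit m) l h2
  have mono2' := countP_take_mono (fun x => !x.testBit m) l h2
  have e1 : (l.take lo).countP (fun x => !x.testBit m) = lo - olo := by omega
  have e2 : (l.take hi).countP (fun x => !x.testBit m) = hi - ohi := by omega
  have e3 : (l.filter fun x => !x.testBit m).length = X.length - o := by
    rw [← List.countP_eq_length_filter, ← List.take_of_length_le (i := X.length) (l := l) hl.le]
    omega
  have hfilter : ∀ β : Bool, (M.filter fun x => x / 2 ^ (m + 1) = r).filter
      (fun x => x.testBit m == β) = M.filter fun x => x / 2 ^ m = 2 * r + β.toNat := by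
    intro β
    rw [List.filter_filter]
    congr 1
    ext x
    rw [Bool.eq_iff_iff]
    simp only [Bool.and_eq_true, beq_iff_eq, decide_eq_true_eq]
    rw [div_two_pow_eq_iff, and_comm]
  have seg0 : segment (splitBit m l) (lo - olo) (hi - ohi) =
      M.filter fun x => x / 2 ^ m = 2 * r := by
    rw [← e1, ← e2, splitBit, segment_filter_append _ _ _ h1, h4]
    convert hfilter false using 2
    · ext x; cases x.testBit m <;> rfl
    · simp
  have seg1 : segment (splitBit m l) (X.length - o + olo) (X.length - o + ohi) =
      M.filter fun x => x / 2 ^ m = 2 * r + 1 := by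
    rw [← e3, hlo, hhi, splitBit, segment_append_filter _ _ _ h1, h4]
    convert hfilter true using 2
    · ext x; cases x.testBit m <;> rfl
    · simp
  have len0 : (M.countP fun x => x / 2 ^ m = 2 * r) = hi - ohi - (lo - olo) := by
    rw [List.countP_eq_length_filter, ← seg0, length_segment]
    rw [length_splitBit]; omega
  refine ⟨by omega, by omega, by omega, by omega, fun hk => ?_, fun hk => ?_⟩
  · refine ⟨by omega, by omega, hk, ?_, ?_⟩
    · rw [hnext, hLt', seg0]
    · rw [hLt', h5, pow_succ, mul_comm (2 ^ m), ← mul_assoc, mul_comm r]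
  · refine ⟨by omega, by omega, by omega, ?_, ?_⟩
    · rw [hnext, hLt', seg1]
    -- The elements below prefix `2 * r + 1` are those below prefix `r` one level up, together with
    -- those of prefix exactly `2 * r`, and the two kinds are disjoint.
    · have hsplit : (M.countP fun x => x < (2 * r + 1) * 2 ^ m) =
          (M.countP fun x => x < r * 2 ^ (m + 1)) + M.countP fun x => x / 2 ^ m = 2 * r := by
        have hpos : 0 < 2 ^ m := by positivity
        have hx : ∀ x, (x < (2 * r + 1) * 2 ^ m) ↔ (x < r * 2 ^ (m + 1) ∨ x / 2 ^ m = 2 * r) := by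
          intro x
          rw [pow_succ, mul_comm (2 ^ m), ← mul_assoc, mul_comm r, ← Nat.div_lt_iff_lt_mul hpos,
            ← Nat.div_lt_iff_lt_mul hpos]
          omega
        have hx' : ∀ x, ¬ (x < r * 2 ^ (m + 1) ∧ x / 2 ^ m = 2 * r) := by
          intro x
          rw [pow_succ, mul_comm (2 ^ m), ← mul_assoc, mul_comm r, ← Nat.div_lt_iff_lt_mul hpos]
          omega
        clear len0 seg0 seg1 hfilter h4 h5
        induction M with
        | nil => rfl
        | cons a M ih =>
          simp only [List.countP_cons, decide_eq_true_eq] at ih ⊢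
          rw [ih]
          have := hx a
          have := hx' a
          split_ifs <;> omega
      rw [hLt', hsplit, len0, h5]
      omega

/-! ### Order statistics and dense ranks -/

/-- The element of a given rank in a sorted list. -/
theorem getElem?_mergeSort (M : List ℕ) (v k : ℕ) (h₁ : (M.countP fun x => x < v) ≤ k)
    (h₂ : k < (M.countP fun x => x < v) + M.count v) :
    (M.mergeSort fun a b => decide (a ≤ b))[k]? = some v := by
  obtain ⟨l, hl⟩ : ∃ l, (M.mergeSort fun a b => decide (a ≤ b)) = l := ⟨_, rfl⟩
  have hperm : l.Perm M := hl ▸ List.mergeSort_perm _ _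
  have hsort : l.Pairwise (· ≤ ·) := by
    have := List.pairwise_mergeSort (le := fun a b : ℕ => decide (a ≤ b))
      (fun a b c hab hbc => by simp at *; omega) (fun a b => by simp; omega) M
    rw [hl] at this
    simpa using this
  rw [hl]
  rw [← hperm.countP_eq] at h₁ h₂
  rw [← hperm.count_eq] at h₂
  have hle : (l.countP fun x => x < v) + l.count v = l.countP fun x => x ≤ v := by
    clear hl hperm hsort h₁ h₂
    induction l with
    | nil => rfl
    | cons a l ih =>
      simp only [List.countP_cons, List.count_cons, decide_eq_true_eq, beq_iff_eq] at ih ⊢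
      split_ifs <;> omega
  have hk : k < l.length := by
    have : (l.countP fun x => decide (x ≤ v)) ≤ l.length := List.countP_le_length
    omega
  rw [List.getElem?_eq_getElem hk]
  congr 1
  by_contra hne
  rcases Nat.lt_or_gt_of_ne hne with hlt | hgt
  -- If the entry at `k` were below `v`, so would be the first `k + 1` entries, more than `h₁`
  -- permits.
  · have h3 : ((l.take (k + 1)).countP fun x => decide (x < v)) = (l.take (k + 1)).length := by
      rw [List.countP_eq_length]
      intro x hx
      obtain ⟨i, hi, rfl⟩ := List.getElem_of_mem hx
      rw [List.length_take] at hi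
      rw [List.getElem_take]
      have : l[i] ≤ l[k] := by
        rcases Nat.lt_or_ge i k with hik | hik
        · exact List.pairwise_iff_getElem.1 hsort _ _ _ _ hik
        · have : i = k := by omega
          subst this; exact le_rfl
      simp only [decide_eq_true_eq]; omega
    have h4 := (List.take_sublist (k + 1) l).countP_le (p := fun x => decide (x < v))
    rw [h3, List.length_take] at h4
    omega
  -- If it were above `v`, all entries that are at most `v` would be among the first `k`, against
  -- `h₂`.
  · have h3 : ((l.drop k).countP fun x => decide (x ≤ v)) = 0 := by
      rw [List.countP_eq_zero]
      intro x hx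
      obtain ⟨i, hi, rfl⟩ := List.getElem_of_mem hx
      rw [List.length_drop] at hi
      rw [List.getElem_drop]
      have : l[k] ≤ l[k + i] := by
        rcases Nat.eq_zero_or_pos i with rfl | h0
        · simp
        · exact List.pairwise_iff_getElem.1 hsort _ _ _ _ (by omega)
      simp only [decide_eq_true_eq]; omega
    have h4 : ((l.take k).countP fun x => decide (x ≤ v)) ≤ (l.take k).length :=
      List.countP_le_length
    rw [List.length_take] at h4
    have h5 := List.countP_append (p := fun x => decide (x ≤ v)) (l₁ := l.take k) (l₂ := l.drop k)
    rw [List.take_append_drop, h3] at h5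
    omega

section Values
variable {S : List ℕ}

/-- The number of distinct values of a list below `v`. -/
def denseRank (S : List ℕ) (v : ℕ) : ℕ := Nat.count (· ∈ S) v

/-- The `r`-th smallest distinct value of a list. -/
noncomputable def distinctValue (S : List ℕ) (r : ℕ) : ℕ := Nat.nth (· ∈ S) r

theorem denseRank_lt {v : ℕ} (hv : v ∈ S) : denseRank S v < S.toFinset.card := by
  rw [denseRank, Nat.count_eq_card_filter_range]
  refine Finset.card_lt_card (Finset.ssubset_iff_of_subset ?_ |>.2 ⟨v, by simpa using hv, by simp⟩)
  intro x hx
  simpa using (Finset.mem_filter.1 hx).2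

theorem distinctValue_denseRank {v : ℕ} (hv : v ∈ S) : distinctValue S (denseRank S v) = v :=
  Nat.nth_count hv

theorem denseRank_lt_iff {v x : ℕ} (hx : x ∈ S) :
    denseRank S x < denseRank S v ↔ x < v := by
  constructor
  · intro h
    by_contra hle
    exact absurd (Nat.count_monotone (· ∈ S) (not_lt.1 hle)) (not_le.2 h)
  · exact fun h => Nat.count_strict_mono (p := (· ∈ S)) hx h

theorem denseRank_eq_iff {v x : ℕ} (hv : v ∈ S) (hx : x ∈ S) :
    denseRank S x = denseRank S v ↔ x = v :=
  ⟨fun h => Nat.count_injective (p := (· ∈ S)) hx hv h, fun h => h ▸ rfl⟩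

theorem card_setOf_mem (S : List ℕ) (hf : {x | x ∈ S}.Finite) :
    hf.toFinset.card = S.toFinset.card := by
  congr 1
  ext x
  simp

theorem distinctValue_mem {r : ℕ} (hr : r < S.toFinset.card) : distinctValue S r ∈ S :=
  Nat.nth_mem (p := (· ∈ S)) r fun hf => by rwa [card_setOf_mem]

theorem distinctValue_lt {r r' : ℕ} (h : r < r') (hr : r' < S.toFinset.card) :
    distinctValue S r < distinctValue S r' :=
  Nat.nth_lt_nth' (p := (· ∈ S)) h fun hf => by rwa [card_setOf_mem]

/-- A query on the dense ranks answers the query on the values. -/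
theorem quantile_of_denseRank {M : List ℕ} (hM : ∀ x ∈ M, x ∈ S) {r k₀ k : ℕ}
    (hk₀ : k₀ = ((M.map (denseRank S)).countP fun x => x < r) + k)
    (hk : k < (M.map (denseRank S)).count r) :
    r < S.toFinset.card ∧
    (M.mergeSort fun a b => decide (a ≤ b))[k₀]? = some (distinctValue S r) ∧
      (M.map (denseRank S)).count r = M.count (distinctValue S r) := by
  obtain ⟨v, hvM, rfl⟩ := List.mem_map.1 (List.count_pos_iff.1 (Nat.zero_lt_of_lt hk))
  have hv := hM v hvM
  rw [distinctValue_denseRank hv]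
  have hcount : (M.map (denseRank S)).count (denseRank S v) = M.count v := by
    rw [List.count, List.countP_map, List.count]
    refine List.countP_congr fun x hx => ?_
    simpa using denseRank_eq_iff hv (hM x hx)
  have hcountP : ((M.map (denseRank S)).countP fun x => x < denseRank S v) =
      M.countP fun x => x < v := by
    rw [List.countP_map]
    refine List.countP_congr fun x hx => ?_
    simpa using denseRank_lt_iff (hM x hx)
  rw [hcountP] at hk₀
  refine ⟨denseRank_lt hv, getElem?_mergeSort M v k₀ (by omega) (by omega), hcount⟩

end Values

/-! ### Locating a mark by rank -/

/-- The characteristic bits of the numbers `g 0, …, g (u - 1)`. -/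
def marks (g : ℕ → ℕ) (u p : ℕ) : Bool := decide (∃ r < u, g r = p)

/-- Exactly `r` marks precede position `g r`, because `g` is strictly increasing. Comparing a rank
with `r` therefore tells on which side of the mark a position lies, which is the test of the binary
search. -/
theorem ones_marks_le_iff {g : ℕ → ℕ} {u : ℕ} (hg : ∀ r r', r < r' → r' < u → g r < g r') {r : ℕ}
    (hr : r < u) (p : ℕ) : ones (marks g u) p ≤ r ↔ p ≤ g r := by
  have hmono : ∀ a b, a < u → b < u → (g a < g b ↔ a < b) := by
    intro a b ha hb
    refine ⟨fun h => ?_, fun h => hg a b h hb⟩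
    by_contra hle
    rcases Nat.lt_or_ge b a with h1 | h1
    · have := hg b a h1 ha; omega
    · have : a = b := by omega
      subst this; omega
  have hcount : ones (marks g u) (g r) = r := by
    rw [ones, Nat.count_eq_card_filter_range]
    have : (Finset.range (g r)).filter (fun t => marks g u t = true) =
        (Finset.range r).image g := by
      ext x
      simp only [Finset.mem_filter, Finset.mem_range, Finset.mem_image, marks,
        decide_eq_true_eq]
      constructor
      · rintro ⟨hx, a, ha, rfl⟩
        exact ⟨a, (hmono a r ha hr).1 hx, rfl⟩
      · rintro ⟨a, ha, rfl⟩
        exact ⟨hg a r ha hr, a, ha.trans hr, rfl⟩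
    rw [this, Finset.card_image_of_injOn, Finset.card_range]
    intro a ha b hb hab
    simp only [Finset.coe_range, Set.mem_Iio] at ha hb
    rcases Nat.lt_trichotomy a b with h | h | h
    · have := hg a b h (hb.trans hr); omega
    · exact h
    · have := hg b a h (ha.trans hr); omega
  constructor
  · intro h
    by_contra hlt
    have h1 := ones_mono (marks g u) (Nat.succ_le_of_lt (not_le.1 hlt))
    have h2 : ones (marks g u) (g r + 1) = r + 1 := by
      have : marks g u (g r) = true := by simpa [marks] using ⟨r, hr, rfl⟩
      rw [ones, Nat.count_succ, if_pos this]
      exact congrArg (· + 1) hcount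
    simp only [Nat.succ_eq_add_one] at h1
    omega
  · intro h
    exact (ones_mono _ h).trans hcount.le

/-! ### Choice of parameters and size of the structure -/

/-- The block length for sequences of length `n`. -/
def blockLength (n : ℕ) : ℕ := Nat.log 2 n / 4 + 1

/-- The number of bits of a block that are not in its tail. -/
def classWidth (n : ℕ) : ℕ := Nat.log 2 (blockLength n) + 1

/-- The number of blocks in a group. -/
def groupLength (n : ℕ) : ℕ := blockLength n / (classWidth n + 1) + 1

section Sizes
variable {n : ℕ}

theorem blockLength_pos (n : ℕ) : 0 < blockLength n := Nat.succ_pos _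

/-- The divisor 4 in the block length leaves room for table indices of about two blocks and for the
polynomial factors in the table sizes, all within `2 ^ (4 * b) = O(n)`. -/
theorem two_pow_blockLength_le (hn : 1 ≤ n) : 2 ^ (4 * blockLength n) ≤ 16 * n := by
  have h1 : 4 * blockLength n ≤ Nat.log 2 n + 4 := by unfold blockLength; omega
  calc 2 ^ (4 * blockLength n) ≤ 2 ^ (Nat.log 2 n + 4) := Nat.pow_le_pow_right (by norm_num) h1
    _ = 2 ^ Nat.log 2 n * 16 := by rw [pow_add]; norm_num
    _ ≤ 16 * n := by have := Nat.pow_log_le_self 2 (x := n) (by omega); omega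

theorem lt_two_pow_blockLength (n : ℕ) : n < 2 ^ (4 * blockLength n) := by
  refine (Nat.lt_pow_succ_log_self (b := 2) (by norm_num) n).trans_le ?_
  exact Nat.pow_le_pow_right (by norm_num) (by unfold blockLength; omega)

theorem log_add_one_le (hn : 1 ≤ n) : Nat.log 2 n + 1 ≤ n := Nat.log_lt_self 2 (by omega)

theorem blockLength_le (hn : 1 ≤ n) : blockLength n ≤ n := by
  have := log_add_one_le hn
  unfold blockLength; omega

theorem classWidth_le (n : ℕ) : classWidth n ≤ blockLength n :=
  log_add_one_le (blockLength_pos n)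

theorem blockLength_lt_two_pow (n : ℕ) : blockLength n + 1 ≤ 2 ^ classWidth n :=
  Nat.lt_pow_succ_log_self (b := 2) (by norm_num) _

theorem two_pow_classWidth_le (n : ℕ) : 2 ^ (classWidth n + 1) ≤ 4 * blockLength n := by
  have := Nat.pow_log_le_self 2 (blockLength_pos n).ne'
  unfold classWidth
  rw [pow_succ, pow_succ]
  omega

theorem classWidth_sq_le (n : ℕ) : (classWidth n + 1) * (classWidth n + 1) ≤
    5 * blockLength n := by
  have h1 : ∀ m : ℕ, (m + 2) * (m + 2) ≤ 5 * 2 ^ m := by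
    intro m
    induction m with
    | zero => norm_num
    | succ m ih =>
      rcases m with _ | m
      · norm_num
      · rw [pow_succ]; nlinarith
  exact (h1 (Nat.log 2 (blockLength n))).trans
    (Nat.mul_le_mul_left _ (Nat.pow_log_le_self 2 (blockLength_pos n).ne'))

theorem le_groupLength_mul (n : ℕ) : blockLength n ≤ groupLength n * (classWidth n + 1) := by
  have h1 := Nat.div_add_mod (blockLength n) (classWidth n + 1)
  have h2 := Nat.mod_lt (blockLength n) (show 0 < classWidth n + 1 by omega)
  rw [groupLength, Nat.succ_mul, mul_comm (blockLength n / _)]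
  omega

theorem groupLength_mul_le (n : ℕ) :
    groupLength n * (classWidth n + 1) ≤ blockLength n + (classWidth n + 1) := by
  rw [groupLength, Nat.succ_mul]
  have := Nat.div_mul_le_self (blockLength n) (classWidth n + 1)
  omega

theorem groupLength_le (n : ℕ) : groupLength n ≤ blockLength n + 1 :=
  Nat.succ_le_succ (Nat.div_le_self _ _)

/-- A group has at least a constant times as many blocks as a head has bits. A group counter thus
costs a constant number of bits per block. -/
theorem classWidth_le_groupLength (n : ℕ) : classWidth n + 1 ≤ 5 * groupLength n := by
  have h1 := classWidth_sq_le n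
  have h2 := le_groupLength_mul n
  have h3 : (classWidth n + 1) * (classWidth n + 1) ≤
      5 * groupLength n * (classWidth n + 1) := by rw [mul_assoc]; omega
  exact Nat.le_of_mul_le_mul_right h3 (by omega)

/-- A superblock has fewer than `(2 * b + 2) ^ 2` bits, and `2 * b + 2 ≤ 2 ^ (classWidth n + 1)`. -/
theorem superblock_lt (n : ℕ) : (classWidth n + 1) * groupLength n * blockLength n <
    2 ^ (classWidth n + 1 + (classWidth n + 1)) := by
  have h1 := groupLength_mul_le n
  have h2 := classWidth_le n
  have h3 := blockLength_lt_two_pow n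
  have h4 := blockLength_pos n
  rw [pow_add, pow_succ, mul_comm (classWidth n + 1)]
  calc groupLength n * (classWidth n + 1) * blockLength n
      ≤ (2 * blockLength n + 1) * blockLength n := Nat.mul_le_mul_right _ (by omega)
    _ < (2 * blockLength n + 2) * (2 * blockLength n + 2) := by nlinarith
    _ ≤ _ := Nat.mul_le_mul (by omega) (by omega)

/-- The layout that is used for sequences of length `n`. -/
def sequenceLayout (n L N : ℕ) : Layout :=
  layout (blockLength n) (groupLength n) (classWidth n + 1) (blockLength n - classWidth n)
    (7 * blockLength n) L (N / blockLength n / groupLength n + 1) (13 * (32 * n))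

theorem lt_two_pow_width {N : ℕ} (hN : N ≤ n * (4 * blockLength n + 4)) :
    N < 2 ^ (7 * blockLength n) := by
  have h1 := lt_two_pow_blockLength n
  have h2 : 4 * blockLength n + 4 ≤ 2 ^ (3 * blockLength n) := by
    have h3 : blockLength n + 1 ≤ 2 ^ blockLength n := Nat.lt_two_pow_self
    have h4 : 2 ^ 2 ≤ 2 ^ (2 * blockLength n) :=
      Nat.pow_le_pow_right (by norm_num) (by have := blockLength_pos n; omega)
    calc 4 * blockLength n + 4 = 2 ^ 2 * (blockLength n + 1) := by ring
      _ ≤ 2 ^ (2 * blockLength n) * 2 ^ blockLength n := Nat.mul_le_mul h4 h3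
      _ = 2 ^ (3 * blockLength n) := by rw [← pow_add]; congr 1; ring
  calc N ≤ n * (4 * blockLength n + 4) := hN
    _ < 2 ^ (4 * blockLength n) * (4 * blockLength n + 4) :=
        Nat.mul_lt_mul_of_pos_right h1 (by omega)
    _ ≤ 2 ^ (4 * blockLength n) * 2 ^ (3 * blockLength n) := Nat.mul_le_mul_left _ h2
    _ = 2 ^ (7 * blockLength n) := by rw [← pow_add]; congr 1; ring

/-- The header takes `13 * 32 * n = 416 * n` bits. Since `N / b ≤ 8 * n`, a constant number of extra
bits per block is affordable: `s1` bounds heads and tails, `s2` group counters, `s3` superblock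
counters, `s4` and `s5` the two tables, with overheads 24 + 100 + 77 + 448 + 224 ≤ 900. The lower
bound is used later to keep parameters and positions in range. -/
theorem sequenceLayout_size (hn : 1 ≤ n) {N : ℕ} (hN : N ≤ n * (4 * blockLength n + 4)) (L : ℕ) :
    (sequenceLayout n L N).aL ≤ 416 * n + N + 900 * n ∧
      N + 416 * n ≤ (sequenceLayout n L N).aL := by
  have p1 := two_pow_blockLength_le hn
  have p2 := blockLength_le hn
  have p3 := classWidth_le n
  have p4 := two_pow_classWidth_le n
  have p5 := le_groupLength_mul n
  have p6 := groupLength_mul_le n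
  have p7 := groupLength_le n
  have p8 := classWidth_le_groupLength n
  have b0 := blockLength_pos n
  have T0 : 0 < groupLength n := Nat.succ_pos _
  have hpow : blockLength n + 1 ≤ 2 ^ blockLength n := Nat.lt_two_pow_self
  obtain ⟨tw, htw⟩ := Nat.exists_eq_add_of_le p3
  unfold sequenceLayout layout
  simp only []
  rw [show blockLength n - classWidth n = tw by omega]
  generalize blockLength n = b at *
  generalize groupLength n = T at *
  obtain ⟨h, hh⟩ : ∃ h, classWidth n + 1 = h := ⟨_, rfl⟩
  rw [hh] at p4 p5 p6 p8 ⊢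
  obtain ⟨nb, hnb⟩ : ∃ nb, N / b = nb := ⟨_, rfl⟩
  obtain ⟨ng, hng⟩ : ∃ ng, nb / T + 1 = ng := ⟨_, rfl⟩
  rw [hnb, hng]
  have h0 : 0 < h := by omega
  have nb8 : nb ≤ 8 * n := by
    rw [← hnb]
    refine Nat.div_le_of_le_mul (hN.trans ?_)
    nlinarith
  have nbN : nb * b ≤ N := hnb ▸ Nat.div_mul_le_self _ _
  have ngT : ng * T ≤ nb + T := by
    rw [← hng, Nat.succ_mul]
    have := Nat.div_mul_le_self nb T
    omega
  have ngT' : nb < ng * T := by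
    rw [← hng]
    exact (Nat.div_lt_iff_lt_mul T0).1 (Nat.lt_succ_self _)
  have ngTb : N < ng * T * b := by
    rw [← Nat.div_lt_iff_lt_mul b0, hnb]; exact ngT'
  have pow4 : 2 ^ (4 * b) = 2 ^ b * 2 ^ b * 2 ^ b * 2 ^ b := by
    rw [← pow_add, ← pow_add, ← pow_add]; congr 1; ring
  have one_le : 1 ≤ 2 ^ b := Nat.one_le_two_pow
  have hblocks : ng * T * h + ng * T * tw = ng * T * b + ng * T := by
    rw [← mul_add, ← Nat.mul_succ]; congr 1; omega
  have s1 : ng * T * b + ng * T ≤ N + 24 * n := by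
    calc ng * T * b + ng * T = ng * T * (b + 1) := by ring
      _ ≤ (nb + T) * (b + 1) := Nat.mul_le_mul_right _ ngT
      _ = nb * b + nb + T * (b + 1) := by ring
      _ ≤ N + 8 * n + 16 * n := by
        have : T * (b + 1) ≤ 2 ^ b * 2 ^ b := Nat.mul_le_mul (p7.trans hpow) hpow
        have : 2 ^ b * 2 ^ b ≤ 2 ^ (4 * b) := by
          rw [← pow_add]; exact Nat.pow_le_pow_right (by norm_num) (by omega)
        omega
      _ = N + 24 * n := by ring
  have s2 : ng * (h + h) ≤ 100 * n := by
    calc ng * (h + h) ≤ ng * (10 * T) := Nat.mul_le_mul_left _ (by omega)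
      _ = 10 * (ng * T) := by ring
      _ ≤ 100 * n := by omega
  have s3 : (ng / h + 1) * (7 * b) ≤ 77 * n := by
    have h1 : ng / h * b ≤ ng * T := by
      calc ng / h * b ≤ ng / h * (T * h) := Nat.mul_le_mul_left _ p5
        _ = ng / h * h * T := by ring
        _ ≤ ng * T := Nat.mul_le_mul_right _ (Nat.div_mul_le_self _ _)
    calc (ng / h + 1) * (7 * b) = 7 * (ng / h * b) + 7 * b := by ring
      _ ≤ 77 * n := by omega
  have s4 : 2 ^ (T * h) * T * (7 * b) ≤ 448 * n := by
    have h1 : 2 ^ (T * h) ≤ 2 ^ b * (4 * 2 ^ b) := by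
      calc 2 ^ (T * h) ≤ 2 ^ (b + h) := Nat.pow_le_pow_right (by norm_num) p6
        _ = 2 ^ b * 2 ^ h := pow_add ..
        _ ≤ 2 ^ b * (4 * 2 ^ b) := Nat.mul_le_mul_left _ (by omega)
    calc 2 ^ (T * h) * T * (7 * b) ≤ 2 ^ b * (4 * 2 ^ b) * 2 ^ b * (7 * 2 ^ b) :=
          Nat.mul_le_mul (Nat.mul_le_mul h1 (p7.trans hpow)) (by omega)
      _ = 28 * 2 ^ (4 * b) := by rw [pow4]; ring
      _ ≤ 448 * n := by omega
  have s5 : 2 ^ (b + 1) * b * (7 * b) ≤ 224 * n := by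
    calc 2 ^ (b + 1) * b * (7 * b) ≤ 2 ^ (b + 1) * 2 ^ b * (7 * 2 ^ b) :=
          Nat.mul_le_mul (Nat.mul_le_mul_left _ (by omega)) (by omega)
      _ = 14 * (2 ^ b * 2 ^ b * 2 ^ b) := by rw [pow_succ]; ring
      _ ≤ 14 * 2 ^ (4 * b) := by
        rw [pow4]; exact Nat.mul_le_mul_left _ (Nat.le_mul_of_pos_right _ (by omega))
      _ ≤ 224 * n := by omega
  constructor <;> omega

end Sizes

/-! ### Rounded logarithms -/

theorem two_pow_clog_le {x : ℕ} (hx : 1 ≤ x) : 2 ^ Nat.clog 2 x ≤ 2 * x := by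
  rcases Nat.eq_or_lt_of_le hx with rfl | h
  · simp
  · have h1 := Nat.pow_pred_clog_lt_self (b := 2) (by norm_num) h
    have h2 := Nat.clog_pos (b := 2) (by norm_num) h
    obtain ⟨c, hc⟩ : ∃ c, Nat.clog 2 x = c + 1 := ⟨Nat.clog 2 x - 1, by omega⟩
    rw [hc] at h1 ⊢
    simp only [Nat.pred_eq_sub_one, Nat.add_sub_cancel] at h1
    rw [pow_succ]; omega

theorem clog_le_logb_add_one {x : ℕ} (hx : 1 ≤ x) :
    (Nat.clog 2 x : ℝ) ≤ Real.logb 2 x + 1 := by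
  have h1 : ((2 : ℝ) ^ Nat.clog 2 x) ≤ 2 * x := by exact_mod_cast two_pow_clog_le hx
  have hx' : (0 : ℝ) < x := by exact_mod_cast hx
  have h2 := Real.logb_le_logb_of_le (b := 2) (by norm_num) (by positivity) h1
  rw [Real.logb_mul (by norm_num) hx'.ne', Real.logb_self_eq_one (by norm_num),
    Real.logb_pow, Real.logb_self_eq_one (by norm_num)] at h2
  linarith

theorem logb_le_clog {x : ℕ} (hx : 1 ≤ x) : Real.logb 2 x ≤ Nat.clog 2 x := by
  have h1 : (x : ℝ) ≤ 2 ^ Nat.clog 2 x := by exact_mod_cast Nat.le_pow_clog (by norm_num) x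
  have hx' : (0 : ℝ) < x := by exact_mod_cast hx
  have h2 := Real.logb_le_logb_of_le (b := 2) (by norm_num) hx' h1
  rwa [Real.logb_pow, Real.logb_self_eq_one (by norm_num), mul_one] at h2

/-! ### The complete representation of a sequence -/

section Structure

/-- The number of bits of a dense rank. -/
def rankWidth (S : List ℕ) : ℕ := Nat.clog 2 S.toFinset.card

/-- The position of the mark of the `r`-th distinct value, where the lowest `l` bits of the value
are stored elsewhere. -/
noncomputable def markPosition (S : List ℕ) (l r : ℕ) : ℕ := (distinctValue S r - 1) / 2 ^ l + r

/-- All bits with rank support. -/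
noncomputable def sequenceBits (S : List ℕ) (l : ℕ) : ℕ → Bool :=
  structureBits (S.map (denseRank S)) (rankWidth S) (marks (markPosition S l) S.toFinset.card)

/-- The bit string `D` with the layout `Λ` represents the sequence `S` over `[1, σ]`. -/
structure Represents (D : List Bool) (Λ : Layout) (S : List ℕ) (σ : ℕ) : Prop where
  levels : Λ.L = rankWidth S
  levels_le : Λ.L ≤ Nat.clog 2 σ
  header_le : 13 * (32 * S.length) ≤ D.length
  header : ∀ i < 13, field D (i * (32 * S.length)) (32 * S.length) = Λ.fields.getD i 0
  ranks : IsRankIndex D Λ (S.length * Λ.L + 2 ^ (Λ.L + 1)) (D.length + 1)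
    (ones (sequenceBits S (Nat.clog 2 σ - Λ.L)))
  low_le : ∀ r < S.toFinset.card, Λ.aL + r * (Nat.clog 2 σ - Λ.L) ≤ D.length
  low : ∀ r < S.toFinset.card,
    field D (Λ.aL + r * (Nat.clog 2 σ - Λ.L)) (Nat.clog 2 σ - Λ.L) =
      (distinctValue S r - 1) % 2 ^ (Nat.clog 2 σ - Λ.L)

variable {S : List ℕ} {σ : ℕ}

theorem card_le_of_bounds (hσ : ∀ x ∈ S, 1 ≤ x ∧ x ≤ σ) : S.toFinset.card ≤ σ := by
  have : S.toFinset ⊆ Finset.Icc 1 σ := fun x hx =>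
    Finset.mem_Icc.2 (hσ x (by simpa using hx))
  simpa using Finset.card_le_card this

/-- The levels contribute `n * log u`, and the low parts at most `n * (log σ - log u + 1)`; the
terms in `log u` cancel, and everything else is linear in `n`. The extra 1 on the left lets
addresses run up to `D.length` inclusive. -/
theorem exists_represents (hS : 1 ≤ S.length) (hσ : ∀ x ∈ S, 1 ≤ x ∧ x ≤ σ) :
    ∃ (D : List Bool) (Λ : Layout), Represents D Λ S σ ∧
      (D.length + 1 : ℝ) ≤ S.length * Real.logb 2 σ + 1400 * S.length := by
  obtain ⟨n, hn⟩ : ∃ n, S.length = n := ⟨_, rfl⟩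
  obtain ⟨u, hu⟩ : ∃ u, S.toFinset.card = u := ⟨_, rfl⟩
  have hun : u ≤ n := hu ▸ hn ▸ S.toFinset_card_le
  have huσ : u ≤ σ := hu ▸ card_le_of_bounds hσ
  have hu1 : 1 ≤ u := by
    rw [← hu]
    exact Finset.card_pos.2 (by
      obtain ⟨x, hx⟩ := List.exists_mem_of_length_pos hS
      exact ⟨x, by simpa using hx⟩)
  rw [hn] at hS
  have hσ1 : 1 ≤ σ := hu1.trans huσ
  obtain ⟨L, hL⟩ : ∃ L, rankWidth S = L := ⟨_, rfl⟩
  have hLu : L = Nat.clog 2 u := by rw [← hL, rankWidth, hu]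
  have hLσ : L ≤ Nat.clog 2 σ := hLu ▸ Nat.clog_mono_right 2 huσ
  obtain ⟨l, hl⟩ : ∃ l, Nat.clog 2 σ - L = l := ⟨_, rfl⟩
  have h2L : 2 ^ L ≤ 2 * u := hLu ▸ two_pow_clog_le hu1
  have hLb : L ≤ 4 * blockLength n := by
    rw [hLu]
    refine (Nat.clog_le_iff_le_pow (by norm_num)).2 ?_
    exact (hun.trans (lt_two_pow_blockLength n).le)
  obtain ⟨N, hN⟩ : ∃ N, n * L + 2 ^ (L + 1) = N := ⟨_, rfl⟩
  -- The marks live in a universe of size `2 ^ (L + 1) ≤ 4 * u`, which is linear in `n`.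
  have hN4 : N ≤ n * L + 4 * u := by rw [← hN, pow_succ]; omega
  have hNb : N ≤ n * (4 * blockLength n + 4) := by
    have : n * L ≤ n * (4 * blockLength n) := Nat.mul_le_mul_left _ hLb
    rw [mul_add]; omega
  obtain ⟨hsize, hsize'⟩ := sequenceLayout_size hS hNb L
  have htw : blockLength n = classWidth n + (blockLength n - classWidth n) := by
    have := classWidth_le n; omega
  have hT0 : 0 < groupLength n := Nat.succ_pos _
  obtain ⟨body, hbody, hindex⟩ := exists_rankIndex (blockLength_pos n)
    hT0 (blockLength_lt_two_pow n) htw (superblock_lt n)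
    (sequenceBits S l) (lt_two_pow_width hNb) L (13 * (32 * n))
  obtain ⟨Λ, hΛ⟩ : ∃ Λ, sequenceLayout n L N = Λ := ⟨_, rfl⟩
  change _ = (sequenceLayout n L N).aL at hbody
  change ∀ (pre post : List Bool) (M : ℕ), _ → _ → _ → _ → _ → _ → _ → _ →
    IsRankIndex _ (sequenceLayout n L N) N M _ at hindex
  have q1 := blockLength_le hS
  have q2 := classWidth_le n
  have q3 := groupLength_mul_le n
  have q4 := groupLength_le n
  have hLn : L ≤ n := by
    rw [hLu]
    refine (Nat.clog_le_iff_le_pow (by norm_num)).2 ?_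
    exact hun.trans Nat.lt_two_pow_self.le
  -- Header entries are at most quadratic in `n`, so `32 * n` bits are ample. This width is
  -- computable from `n` alone, independent of `w`, and still costs only O(n) bits.
  have hfields : ∀ x ∈ Λ.fields, x < 2 ^ (32 * n) := by
    have hle : ∀ x ∈ Λ.fields, x ≤ Λ.aL := by
      rw [hΛ] at hsize'
      have e1 : Λ.b = blockLength n := by rw [← hΛ]; rfl
      have e2 : Λ.T = groupLength n := by rw [← hΛ]; rfl
      have e3 : Λ.h = classWidth n + 1 := by rw [← hΛ]; rfl
      have e4 : Λ.tw = blockLength n - classWidth n := by rw [← hΛ]; rfl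
      have e5 : Λ.W = 7 * blockLength n := by rw [← hΛ]; rfl
      have e6 : Λ.L = L := by rw [← hΛ]; rfl
      have m1 : Λ.aS ≤ Λ.aG := by rw [← hΛ]; exact Nat.le_add_right _ _
      have m2 : Λ.aG ≤ Λ.aH := by rw [← hΛ]; exact Nat.le_add_right _ _
      have m3 : Λ.aH ≤ Λ.aT := by rw [← hΛ]; exact Nat.le_add_right _ _
      have m4 : Λ.aT ≤ Λ.a1 := by rw [← hΛ]; exact Nat.le_add_right _ _
      have m5 : Λ.a1 ≤ Λ.a2 := by rw [← hΛ]; exact Nat.le_add_right _ _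
      have m6 : Λ.a2 ≤ Λ.aL := by rw [← hΛ]; exact Nat.le_add_right _ _
      intro x hx
      simp only [Layout.fields, List.mem_cons, List.not_mem_nil, or_false] at hx
      rcases hx with rfl | rfl | rfl | rfl | rfl | rfl | rfl | rfl | rfl | rfl | rfl | rfl | rfl <;>
        omega
    intro x hx
    refine (hle x hx).trans_lt ?_
    rw [hΛ] at hsize
    have h1 : N ≤ n * (8 * n) := hNb.trans (Nat.mul_le_mul_left _ (by omega))
    have h2 : n + 1 ≤ 2 ^ n := Nat.lt_two_pow_self
    calc Λ.aL ≤ 1316 * n + n * (8 * n) := by omega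
      _ < 2 ^ 11 * ((n + 1) * (n + 1)) := by nlinarith
      _ ≤ 2 ^ (11 * n) * (2 ^ n * 2 ^ n) :=
          Nat.mul_le_mul (Nat.pow_le_pow_right (by norm_num) (by omega)) (Nat.mul_le_mul h2 h2)
      _ = 2 ^ (13 * n) := by rw [← pow_add, ← pow_add]; congr 1; ring
      _ ≤ 2 ^ (32 * n) := Nat.pow_le_pow_right (by norm_num) (by omega)
  let hdr := packed (32 * n) (fun i => Λ.fields.getD i 0) 13
  let low := packed l (fun r => distinctValue S r - 1) u
  have hlen : (hdr ++ (body ++ low)).length = Λ.aL + u * l := by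
    simp only [List.length_append, hdr, low, length_packed]
    rw [hΛ] at hbody
    omega
  rw [hΛ] at hsize hsize' hbody hindex
  have hΛL : Λ.L = L := by rw [← hΛ]; rfl
  refine ⟨hdr ++ (body ++ low), Λ, ⟨?_, ?_, ?_, ?_, ?_, ?_, ?_⟩, ?_⟩
  · rw [hΛL, hL]
  · rw [hΛL]; exact hLσ
  · rw [hlen, hn]; omega
  · intro i hi
    rw [hn]
    have h1 := field_packed [] (body ++ low) (32 * n) (fun i => Λ.fields.getD i 0) 13 i 0 hi rfl
    rw [zero_add, List.nil_append] at h1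
    rw [h1]
    refine Nat.mod_eq_of_lt (hfields _ ?_)
    have : i < Λ.fields.length := hi
    rw [List.getD_eq_getElem _ _ this]
    exact List.getElem_mem _
  · rw [hΛL, hn, hN, hl]
    refine hindex hdr low _ (by simp [hdr]) (Nat.lt_succ_self _) ?_ ?_ ?_ ?_ ?_ ?_ <;>
      rw [hlen] <;> omega
  · intro r hr
    rw [hu] at hr
    rw [hlen, hΛL, hl]
    exact Nat.add_le_add_left (Nat.mul_le_mul_right _ hr.le) _
  · intro r hr
    rw [hu] at hr
    rw [hΛL, hl]
    have h1 := field_packed (hdr ++ body) [] l (fun r => distinctValue S r - 1) u r Λ.aL hr (by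
      simp only [List.length_append, hdr, length_packed]; omega)
    rw [List.append_nil, List.append_assoc] at h1
    exact h1
  · rw [hlen, hn]
    have c1 := clog_le_logb_add_one hu1
    have c2 := logb_le_clog hu1
    have c3 := clog_le_logb_add_one hσ1
    rw [← hLu] at c1 c2
    have c4 : (l : ℝ) = Nat.clog 2 σ - L := by rw [← hl, Nat.cast_sub hLσ]
    have hun' : (u : ℝ) ≤ n := by exact_mod_cast hun
    have hn' : (1 : ℝ) ≤ n := by exact_mod_cast hS
    have hu' : (1 : ℝ) ≤ u := by exact_mod_cast hu1
    have huσ' : Real.logb 2 u ≤ Real.logb 2 σ :=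
      Real.logb_le_logb_of_le (by norm_num) (by positivity) (by exact_mod_cast huσ)
    have hsz : (Λ.aL : ℝ) ≤ 416 * n + (n * L + 4 * u) + 900 * n := by
      have : Λ.aL ≤ 416 * n + (n * L + 4 * u) + 900 * n := by omega
      exact_mod_cast this
    have hl' : (l : ℝ) ≤ Real.logb 2 σ - Real.logb 2 u + 1 := by rw [c4]; linarith
    have d1 : (n : ℝ) * L ≤ n * (Real.logb 2 u + 1) := mul_le_mul_of_nonneg_left c1 (by positivity)
    have d2 : (u : ℝ) * l ≤ n * (Real.logb 2 σ - Real.logb 2 u + 1) :=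
      mul_le_mul hun' hl' (by positivity) (by positivity)
    push_cast
    nlinarith

/-- The high part is below `2 ^ L` and `r < u ≤ 2 ^ L`, so `L + 1` halvings suffice for the search.
-/
theorem markPosition_lt (hσ : ∀ x ∈ S, 1 ≤ x ∧ x ≤ σ) {L : ℕ} (hL : L = rankWidth S)
    (hLσ : L ≤ Nat.clog 2 σ) {r : ℕ} (hr : r < S.toFinset.card) :
    markPosition S (Nat.clog 2 σ - L) r < 2 ^ (L + 1) := by
  have h1 : distinctValue S r - 1 < 2 ^ L * 2 ^ (Nat.clog 2 σ - L) := by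
    rw [← pow_add, Nat.add_sub_cancel' hLσ]
    have := hσ _ (distinctValue_mem hr)
    have := Nat.le_pow_clog (b := 2) (by norm_num) σ
    omega
  have h2 := (Nat.div_lt_iff_lt_mul (by positivity)).2 h1
  have h3 : S.toFinset.card ≤ 2 ^ L := by rw [hL]; exact Nat.le_pow_clog (by norm_num) _
  rw [markPosition, pow_succ]
  omega

/-- High parts may coincide; the summand `r` separates them. -/
theorem markPosition_strictMono (l r r' : ℕ) (h : r < r') (hr : r' < S.toFinset.card) :
    markPosition S l r < markPosition S l r' := by
  have h1 : (distinctValue S r - 1) / 2 ^ l ≤ (distinctValue S r' - 1) / 2 ^ l :=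
    Nat.div_le_div_right (Nat.sub_le_sub_right (distinctValue_lt h hr).le _)
  unfold markPosition
  omega

end Structure

/-! ### The query program -/

/-- Loads number `i` of the header. -/
def readHeader (i : ℕ) : List (ℕ × Operation) :=
  [(18, .const 32), (18, .bin .mul 18 3), (19, .const i), (20, .const 0)] ++ fetch 20 19 18 ++
    [(30 + i, .copy 12)]

/-- Loads the first `m` numbers of the header. -/
def readHeaders : ℕ → List (ℕ × Operation)
  | 0 => []
  | m + 1 => readHeaders m ++ readHeader m

/-- Initializes the descent through the levels. -/
def setup : List (ℕ × Operation) :=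
  [(60, .const 0), (61, .const 1), (50, .bin .sub 0 61), (51, .copy 1), (52, .bin .sub 2 61),
    (53, .copy 35), (54, .const 0), (55, .const 0), (56, .const 0)]

/-- Counts the ones of the current level before both ends of the range and in the whole level. -/
def levelCounts : List (ℕ × Operation) :=
  [(53, .bin .sub 53 61), (20, .bin .add 55 50)] ++ rank ++
  [(57, .bin .sub 21 56), (20, .bin .add 55 51)] ++ rank ++
  [(58, .bin .sub 21 56), (55, .bin .add 55 3), (20, .copy 55)] ++ rank ++
  [(59, .bin .sub 21 56), (56, .copy 21), (62, .bin .sub 50 57), (63, .bin .sub 51 58),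
    (64, .bin .sub 63 62), (54, .bin .add 54 54)]

theorem length_rank : rank.length = 129 := by
  simp [rank, rankBlocks, fetch, readField]

theorem length_levelCounts : levelCounts.length = 400 := by
  unfold levelCounts
  simp only [List.length_append, length_rank, List.length_cons, List.length_nil]

/-- Descends by one level. -/
def levelStep : Program :=
  .seq (straight levelCounts)
    (.ite (.lt 52 64) (straight [(50, .copy 62), (51, .copy 63)])
      (straight [(52, .bin .sub 52 64), (54, .bin .add 54 61), (65, .bin .sub 3 59),
        (50, .bin .add 65 57), (51, .bin .add 65 58)]))

/-- Outputs the frequency and initializes the search for a mark. -/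
def searchSetup : List (ℕ × Operation) :=
  [(1, .bin .sub 51 50), (53, .bin .shl 61 35), (57, .const 0)]

/-- Halves the interval of the search for a mark. -/
def searchStep : Program :=
  .seq (straight ([(58, .bin .add 57 53), (20, .bin .add 55 58)] ++ rank ++
      [(59, .bin .sub 21 56)]))
    (.seq (.ite (.lt 54 59) (straight []) (straight [(57, .copy 58)]))
      (straight [(53, .bin .shr 53 61)]))

/-- Outputs the value. -/
def output : List (ℕ × Operation) :=
  [(58, .bin .sub 5 35), (57, .bin .sub 57 54)] ++ fetch 42 54 58 ++
    [(57, .bin .shl 57 58), (0, .bin .add 57 12), (0, .bin .add 0 61)]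

/-- The query program. -/
def query : Program :=
  .seq (straight (readHeaders 13 ++ setup))
    (.seq (.loop (.lt 60 53) levelStep)
      (.seq (straight searchSetup)
        (.seq (.loop (.lt 60 53) searchStep) (straight output))))

/-! ### Correctness of the header, the descent and the search -/

/-- What stays in the registers during a query. -/
structure Context {w : ℕ} (Λ : Layout) (n c : ℕ) (s : Registers w) : Prop where
  length : s 3 = BitVec.ofNat w n
  width : s 5 = BitVec.ofNat w c
  wordSize : s 6 = BitVec.ofNat w w
  zero : s 60 = BitVec.ofNat w 0
  one : s 61 = BitVec.ofNat w 1
  loaded : Loaded Λ s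

theorem Loaded.congr {w : ℕ} {Λ : Layout} {s s' : Registers w} (h : Loaded Λ s)
    (hs : ∀ r, 30 ≤ r → r < 43 → s' r = s r) : Loaded Λ s' :=
  fun i hi => (hs _ (by omega) (by omega)).trans (h i hi)

theorem Context.congr {w : ℕ} {Λ : Layout} {n c : ℕ} {s s' : Registers w} (h : Context Λ n c s)
    (hs : ∀ r, (2 < r ∧ r < 10) ∨ (30 ≤ r ∧ r < 43) ∨ r = 60 ∨ r = 61 → s' r = s r) :
    Context Λ n c s' where
  length := (hs 3 (by simp)).trans h.length
  width := (hs 5 (by simp)).trans h.width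
  wordSize := (hs 6 (by simp)).trans h.wordSize
  zero := (hs 60 (by simp)).trans h.zero
  one := (hs 61 (by simp)).trans h.one
  loaded := h.loaded.congr fun r h1 h2 => hs r (by omega)

section Query
variable {w : ℕ} {D : List Bool} {Λ : Layout} {S : List ℕ} {σ : ℕ}

theorem run_readHeaders (hw : 2 ≤ w) (hD : Represents D Λ S σ) (hM : D.length + 1 ≤ 2 ^ w)
    (hS : 1 ≤ S.length)
    {s : Registers w} (h3 : s 3 = BitVec.ofNat w S.length) (h6 : s 6 = BitVec.ofNat w w) {m : ℕ}
    (hm : m ≤ 13) :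
    (∀ i < m, run (memoryOf w D) (readHeaders m) s (30 + i) =
      BitVec.ofNat w (Λ.fields.getD i 0)) ∧
    ∀ r, r < 10 ∨ 43 ≤ r → run (memoryOf w D) (readHeaders m) s r = s r := by
  induction m with
  | zero => exact ⟨fun i hi => absurd hi (Nat.not_lt_zero i), fun r _ => rfl⟩
  | succ m ih =>
    obtain ⟨ih1, ih2⟩ := ih (by omega)
    have hlen := hD.header_le
    rw [readHeaders, run_append]
    generalize run (memoryOf w D) (readHeaders m) s = s₁ at ih1 ih2 ⊢
    rw [readHeader, run_append, run_append]
    obtain ⟨s₂, e₂⟩ : ∃ s₂, run (memoryOf w D) [(18, .const 32), (18, .bin .mul 18 3),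
      (19, .const m), (20, .const 0)] s₁ = s₂ := ⟨_, rfl⟩
    have k : ∀ r, r < 18 ∨ 21 ≤ r → s₂ r = s₁ r := by
      intro r hr
      have h : r ≠ 18 ∧ r ≠ 19 ∧ r ≠ 20 := by omega
      rw [← e₂]
      simp [run, h]
    have k18 : s₂ 18 = BitVec.ofNat w (32 * S.length) := by
      rw [← e₂, BitVec.ofNat_mul, ← h3, ← ih2 3 (by simp)]
      simp [run, Operation.eval, BinOp.eval]
    have k19 : s₂ 19 = BitVec.ofNat w m := by
      rw [← e₂]; simp [run, Operation.eval]
    have k20 : s₂ 20 = BitVec.ofNat w 0 := by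
      rw [← e₂]; simp [run, Operation.eval]
    have hmn : m * (32 * S.length) ≤ 13 * (32 * S.length) := Nat.mul_le_mul_right _ (by omega)
    have v := run_fetch (D := D) (base := 20) (idx := 19) (wd := 18) hw
      ((k 6 (by simp)).trans ((ih2 6 (by simp)).trans h6)) (by norm_num) (by norm_num) k20 k19 k18
      (by omega) (by omega)
    rw [zero_add, hD.header m (by omega)] at v
    rw [e₂, run_single]
    have f : ∀ r, r < 10 ∨ 30 ≤ r →
        run (memoryOf w D) (fetch 20 19 18) s₂ r = s₁ r := fun r hr =>
      (run_fetch_frame (by omega)).trans (k r (by omega))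
    refine ⟨fun i hi => ?_, fun r hr => ?_⟩
    · rcases Nat.lt_succ_iff_lt_or_eq.1 hi with h | rfl
      · rw [Function.update_of_ne (by omega), f _ (by omega)]
        exact ih1 i h
      · rw [Function.update_self]
        exact v
    · rw [Function.update_of_ne (by omega), f _ (by omega), ih2 r hr]

/-- The invariant of the descent, with `m` levels left. -/
def LevelInvariant (Λ : Layout) (S : List ℕ) (σ : ℕ) (M : List ℕ) (k₀ m : ℕ)
    (s : Registers w) : Prop :=
  m ≤ Λ.L ∧ Context Λ S.length (Nat.clog 2 σ) s ∧
  ∃ lo hi k r, QuantileState (S.map (denseRank S)) Λ.L M k₀ (Λ.L - m) lo hi k r ∧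
    s 50 = BitVec.ofNat w lo ∧ s 51 = BitVec.ofNat w hi ∧ s 52 = BitVec.ofNat w k ∧
    s 53 = BitVec.ofNat w m ∧ s 54 = BitVec.ofNat w r ∧
    s 55 = BitVec.ofNat w ((Λ.L - m) * S.length) ∧
    s 56 = BitVec.ofNat w (ones (sequenceBits S (Nat.clog 2 σ - Λ.L)) ((Λ.L - m) * S.length))

theorem rank_call (hw : 2 ≤ w) (hD : Represents D Λ S σ) (hM : D.length + 1 ≤ 2 ^ w)
    {s : Registers w} (hs : Context Λ S.length (Nat.clog 2 σ) s) {p : ℕ}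
    (hp : p ≤ S.length * Λ.L + 2 ^ (Λ.L + 1)) (h20 : s 20 = BitVec.ofNat w p) :
    run (memoryOf w D) rank s 21 =
      BitVec.ofNat w (ones (sequenceBits S (Nat.clog 2 σ - Λ.L)) p) :=
  run_rank hw hs.wordSize hs.loaded hD.ranks hM hp h20

/-- The states `s₁` to `s₄` follow the three rank calls; register 56 holds the number of ones before
the level and is subtracted from each result. The two branches are the two conclusions of
`QuantileState.step`. -/
theorem runs_levelStep (hw : 2 ≤ w) (hD : Represents D Λ S σ) (hM : D.length + 1 ≤ 2 ^ w)
    {M : List ℕ} {k₀ m : ℕ} {s : Registers w} (hs : LevelInvariant Λ S σ M k₀ (m + 1) s) :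
    Runs (memoryOf w D) levelStep s 500 (LevelInvariant Λ S σ M k₀ m) := by
  obtain ⟨hm, hc, lo, hi, k, r, hq, h50, h51, h52, h53, h54, h55, h56⟩ := hs
  obtain ⟨t, ht⟩ : ∃ t, Λ.L - (m + 1) = t := ⟨_, rfl⟩
  have ht' : Λ.L - m = t + 1 := by omega
  have htL : t < Λ.L := by omega
  rw [ht] at hq h55 h56
  set X := S.map (denseRank S) with hX
  have hXl : X.length = S.length := by simp [hX]
  set B := sequenceBits S (Nat.clog 2 σ - Λ.L) with hB
  have hones : ∀ i ≤ S.length, ones B (t * S.length + i) = ones B (t * S.length) +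
      ((level X Λ.L t).take i).countP (·.testBit (Λ.L - 1 - t)) := by
    intro i hi
    have := ones_level X Λ.L (marks (markPosition S (Nat.clog 2 σ - Λ.L)) S.toFinset.card) htL
      (hi.trans hXl.ge)
    rw [hXl, hD.levels] at this
    rw [hB, sequenceBits, hD.levels]
    exact this
  obtain ⟨olo, holo⟩ : ∃ o, ((level X Λ.L t).take lo).countP (·.testBit (Λ.L - 1 - t)) = o :=
    ⟨_, rfl⟩
  obtain ⟨ohi, hohi⟩ : ∃ o, ((level X Λ.L t).take hi).countP (·.testBit (Λ.L - 1 - t)) = o :=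
    ⟨_, rfl⟩
  obtain ⟨o, ho⟩ : ∃ o, ((level X Λ.L t).take X.length).countP (·.testBit (Λ.L - 1 - t)) = o :=
    ⟨_, rfl⟩
  obtain ⟨b1, b2, b3, b4, step0, step1⟩ := hq.step htL holo.symm hohi.symm ho.symm
  have hhi := hq.le_length
  have hlohi := hq.le
  have hklt := hq.lt
  rw [hXl] at ho b4 step1 hhi
  have rlo := hones lo (by omega)
  have rhi := hones hi hhi
  have rn := hones S.length le_rfl
  rw [holo] at rlo
  rw [hohi] at rhi
  rw [ho] at rn
  have hN : t * S.length + S.length ≤ S.length * Λ.L := by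
    rw [← Nat.succ_mul, mul_comm]; exact Nat.mul_le_mul_left _ htL
  have hNlt := hD.ranks.N_lt
  have hnlt : S.length < 2 ^ w := by have := hD.header_le; omega
  obtain ⟨mem, hmem⟩ : ∃ mem, memoryOf w D = mem := ⟨_, rfl⟩
  have call : ∀ {s : Registers w}, Context Λ S.length (Nat.clog 2 σ) s → ∀ {p : ℕ},
      p ≤ t * S.length + S.length → s 20 = BitVec.ofNat w p →
      run mem rank s 21 = BitVec.ofNat w (ones B p) := by
    intro s hs p hp h20
    rw [← hmem]
    exact rank_call hw hD hM hs ((hp.trans hN).trans (Nat.le_add_right _ _)) h20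
  obtain ⟨s₁, e₁⟩ : ∃ s₁, run mem [(53, .bin .sub 53 61), (20, .bin .add 55 50)] s = s₁ :=
    ⟨_, rfl⟩
  have k₁ : ∀ r, r ≠ 53 → r ≠ 20 → s₁ r = s r := fun r h1 h2 => by rw [← e₁]; simp [run, h1, h2]
  have v53 : s₁ 53 = BitVec.ofNat w m := by
    rw [← Nat.add_sub_cancel (n := m) (m := 1), ← ofNat_sub (by omega), ← h53, ← hc.one, ← e₁]
    simp [run, Operation.eval, BinOp.eval]
  have v20 : s₁ 20 = BitVec.ofNat w (t * S.length + lo) := by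
    rw [BitVec.ofNat_add, ← h55, ← h50, ← e₁]
    simp [run, Operation.eval, BinOp.eval]
  have c₁ := hc.congr (s' := s₁) fun r hr => k₁ r (by omega) (by omega)
  have v21 := call c₁ (by omega) v20
  obtain ⟨s₂, e₂⟩ : ∃ s₂, run mem [(57, .bin .sub 21 56), (20, .bin .add 55 51)]
    (run mem rank s₁) = s₂ := ⟨_, rfl⟩
  have k₂ : ∀ r, r < 10 ∨ 30 ≤ r → r ≠ 53 → r ≠ 57 → s₂ r = s r := fun r h1 h2 h3 => by
    rw [← k₁ r h2 (by omega), ← run_rank_frame (mem := mem) (s := s₁) h1, ← e₂]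
    have : r ≠ 20 := by omega
    simp [run, h3, this]
  have w53 : s₂ 53 = BitVec.ofNat w m := by
    rw [← v53, ← run_rank_frame (mem := mem) (s := s₁) (r := 53) (by simp), ← e₂]
    simp [run]
  have w57 : s₂ 57 = BitVec.ofNat w olo := by
    rw [← Nat.add_sub_cancel_left (n := ones B (t * S.length)) (m := olo), ← rlo,
      ← ofNat_sub (by omega), ← v21, ← h56, ← k₁ 56 (by simp) (by simp),
      ← run_rank_frame (mem := mem) (s := s₁) (r := 56) (by simp), ← e₂]
    simp [run, Operation.eval, BinOp.eval]
  have w20 : s₂ 20 = BitVec.ofNat w (t * S.length + hi) := by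
    rw [BitVec.ofNat_add, ← h55, ← h51, ← k₁ 55 (by simp) (by simp), ← k₁ 51 (by simp) (by simp),
      ← run_rank_frame (mem := mem) (s := s₁) (r := 55) (by simp),
      ← run_rank_frame (mem := mem) (s := s₁) (r := 51) (by simp), ← e₂]
    simp [run, Operation.eval, BinOp.eval]
  have c₂ := hc.congr (s' := s₂) fun r hr => k₂ r (by omega) (by omega) (by omega)
  have w21 := call c₂ (by omega) w20
  obtain ⟨s₃, e₃⟩ : ∃ s₃, run mem [(58, .bin .sub 21 56), (55, .bin .add 55 3), (20, .copy 55)]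
    (run mem rank s₂) = s₃ := ⟨_, rfl⟩
  have k₃ : ∀ r, r < 10 ∨ 30 ≤ r → r ≠ 58 → r ≠ 55 → s₃ r = s₂ r := fun r h1 h2 h3 => by
    rw [← run_rank_frame (mem := mem) (s := s₂) h1, ← e₃]
    have : r ≠ 20 := by omega
    simp [run, h2, h3, this]
  have x58 : s₃ 58 = BitVec.ofNat w ohi := by
    rw [← Nat.add_sub_cancel_left (n := ones B (t * S.length)) (m := ohi), ← rhi,
      ← ofNat_sub (by omega), ← w21, ← h56, ← k₂ 56 (by simp) (by simp) (by simp),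
      ← run_rank_frame (mem := mem) (s := s₂) (r := 56) (by simp), ← e₃]
    simp [run, Operation.eval, BinOp.eval]
  have x55 : s₃ 55 = BitVec.ofNat w (t * S.length + S.length) := by
    rw [BitVec.ofNat_add, ← h55, ← c₂.length, ← k₂ 55 (by simp) (by simp) (by simp),
      ← run_rank_frame (mem := mem) (s := s₂) (r := 55) (by simp),
      ← run_rank_frame (mem := mem) (s := s₂) (r := 3) (by simp), ← e₃]
    simp [run, Operation.eval, BinOp.eval]
  have x20 : s₃ 20 = BitVec.ofNat w (t * S.length + S.length) := by
    rw [← x55, ← e₃]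
    simp [run, Operation.eval]
  have c₃ := c₂.congr (s' := s₃) fun r hr => k₃ r (by omega) (by omega) (by omega)
  have x21 := call c₃ le_rfl x20
  obtain ⟨s₄, e₄⟩ : ∃ s₄, run mem [(59, .bin .sub 21 56), (56, .copy 21), (62, .bin .sub 50 57),
    (63, .bin .sub 51 58), (64, .bin .sub 63 62), (54, .bin .add 54 54)]
    (run mem rank s₃) = s₄ := ⟨_, rfl⟩
  obtain ⟨s₃', e₃'⟩ : ∃ s₃', run mem rank s₃ = s₃' := ⟨_, rfl⟩
  have k₃' : ∀ r, r < 10 ∨ 30 ≤ r → s₃' r = s₃ r := fun r h => e₃' ▸ run_rank_frame h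
  rw [e₃'] at e₄ x21
  have y50 : s₃' 50 = BitVec.ofNat w lo := by
    rw [k₃' 50 (by simp), k₃ 50 (by simp) (by simp) (by simp),
      k₂ 50 (by simp) (by simp) (by simp), h50]
  have y51 : s₃' 51 = BitVec.ofNat w hi := by
    rw [k₃' 51 (by simp), k₃ 51 (by simp) (by simp) (by simp),
      k₂ 51 (by simp) (by simp) (by simp), h51]
  have y52 : s₃' 52 = BitVec.ofNat w k := by
    rw [k₃' 52 (by simp), k₃ 52 (by simp) (by simp) (by simp),
      k₂ 52 (by simp) (by simp) (by simp), h52]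
  have y53 : s₃' 53 = BitVec.ofNat w m := by
    rw [k₃' 53 (by simp), k₃ 53 (by simp) (by simp) (by simp), w53]
  have y54 : s₃' 54 = BitVec.ofNat w r := by
    rw [k₃' 54 (by simp), k₃ 54 (by simp) (by simp) (by simp),
      k₂ 54 (by simp) (by simp) (by simp), h54]
  have y55 : s₃' 55 = BitVec.ofNat w ((t + 1) * S.length) := by
    rw [k₃' 55 (by simp), x55, Nat.succ_mul]
  have y56 : s₃' 56 = BitVec.ofNat w (ones B (t * S.length)) := by
    rw [k₃' 56 (by simp), k₃ 56 (by simp) (by simp) (by simp),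
      k₂ 56 (by simp) (by simp) (by simp), h56]
  have y57 : s₃' 57 = BitVec.ofNat w olo := by
    rw [k₃' 57 (by simp), k₃ 57 (by simp) (by simp) (by simp), w57]
  have y58 : s₃' 58 = BitVec.ofNat w ohi := by rw [k₃' 58 (by simp), x58]
  have k₄ : ∀ r, r ≠ 59 → r ≠ 56 → r ≠ 62 → r ≠ 63 → r ≠ 64 → r ≠ 54 → s₄ r = s₃' r := by
    intro r h1 h2 h3 h4 h5 h6
    rw [← e₄]
    simp [run, h1, h2, h3, h4, h5, h6]
  have c₄ := c₃.congr (s' := s₄) fun r hr =>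
    (k₄ r (by omega) (by omega) (by omega) (by omega) (by omega) (by omega)).trans
      (k₃' r (by omega))
  have z59 : s₄ 59 = BitVec.ofNat w o := by
    rw [← Nat.add_sub_cancel_left (n := ones B (t * S.length)) (m := o), ← rn,
      ← ofNat_sub (by omega), ← x21, ← y56, ← e₄]
    simp [run, Operation.eval, BinOp.eval]
  have z56 : s₄ 56 = BitVec.ofNat w (ones B ((t + 1) * S.length)) := by
    rw [Nat.succ_mul, ← x21, ← e₄]
    simp [run, Operation.eval]
  have z62 : s₄ 62 = BitVec.ofNat w (lo - olo) := by
    rw [← ofNat_sub b1, ← y50, ← y57, ← e₄]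
    simp [run, Operation.eval, BinOp.eval]
  have z63 : s₄ 63 = BitVec.ofNat w (hi - ohi) := by
    rw [← ofNat_sub b2, ← y51, ← y58, ← e₄]
    simp [run, Operation.eval, BinOp.eval]
  have z64 : s₄ 64 = BitVec.ofNat w (hi - ohi - (lo - olo)) := by
    rw [← ofNat_sub b3, ← z62, ← z63, ← e₄]
    simp [run, Operation.eval, BinOp.eval]
  have z54 : s₄ 54 = BitVec.ofNat w (2 * r) := by
    rw [two_mul, BitVec.ofNat_add, ← y54, ← e₄]
    simp [run, Operation.eval, BinOp.eval]
  have z52 : s₄ 52 = BitVec.ofNat w k := (k₄ 52 (by simp) (by simp) (by simp) (by simp) (by simp)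
    (by simp)).trans y52
  have z53 : s₄ 53 = BitVec.ofNat w m := (k₄ 53 (by simp) (by simp) (by simp) (by simp) (by simp)
    (by simp)).trans y53
  have z55 : s₄ 55 = BitVec.ofNat w ((t + 1) * S.length) :=
    (k₄ 55 (by simp) (by simp) (by simp) (by simp) (by simp) (by simp)).trans y55
  have z57 : s₄ 57 = BitVec.ofNat w olo := (k₄ 57 (by simp) (by simp) (by simp) (by simp) (by simp)
    (by simp)).trans y57
  have z58 : s₄ 58 = BitVec.ofNat w ohi := (k₄ 58 (by simp) (by simp) (by simp) (by simp) (by simp)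
    (by simp)).trans y58
  have hrun : run mem levelCounts s = s₄ := by
    simp only [levelCounts, run_append, e₁, e₂, e₃, e₃', e₄]
  rw [hmem]
  have htest : Test.Holds s₄ (.lt 52 64) ↔ k < hi - ohi - (lo - olo) := by
    change s₄ 52 < s₄ 64 ↔ _
    rw [z52, z64, ofNat_lt_ofNat (by omega) (by omega)]
  have main : Runs mem levelStep s (levelCounts.length + 1 + (1 + 6))
      (LevelInvariant Λ S σ M k₀ m) := by
    refine Runs.seq (runs_straight levelCounts (Q := (· = s₄)) hrun) ?_
    rintro _ rfl
    refine Runs.ite (fun hb => ?_) (fun hb => ?_)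
    · refine Runs.mono (runs_straight _ (Q := LevelInvariant Λ S σ M k₀ m) ?_)
        (by simp) (fun _ h => h)
      refine ⟨by omega, c₄.congr fun r hr => ?_, _, _, _, _, ht' ▸ step0 (htest.1 hb), ?_⟩
      · have h : r ≠ 50 ∧ r ≠ 51 := by omega
        simp [run, h]
      · rw [ht']
        simp [run, Operation.eval, z62, z63, z52, z53, z54, z55, z56, hB]
    · refine Runs.mono (runs_straight _ (Q := LevelInvariant Λ S σ M k₀ m) ?_)
        (by simp) (fun _ h => h)
      have hb' := mt htest.2 hb
      refine ⟨by omega, c₄.congr fun r hr => ?_, _, _, _, _, ht' ▸ step1 hb', ?_⟩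
      · have h : r ≠ 50 ∧ r ≠ 51 ∧ r ≠ 52 ∧ r ≠ 54 ∧ r ≠ 65 := by omega
        simp [run, h]
      · rw [ht', BitVec.ofNat_add, BitVec.ofNat_add, ← ofNat_sub b4, ← ofNat_sub (not_lt.1 hb'),
          BitVec.ofNat_add]
        simp [run, Operation.eval, BinOp.eval, z52, z53, z54, z55, z56, z57, z58, z59, z64,
          c₄.length, c₄.one, hB]
  exact main.mono (by rw [length_levelCounts]; norm_num) fun _ h => h

/-- The invariant of the search for the mark of the `r`-th value, with `c` rounds left. -/
def SearchInvariant (Λ : Layout) (S : List ℕ) (σ r cnt c : ℕ) (s : Registers w) : Prop :=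
  Context Λ S.length (Nat.clog 2 σ) s ∧ c ≤ Λ.L + 1 ∧
  s 1 = BitVec.ofNat w cnt ∧ s 54 = BitVec.ofNat w r ∧
  s 55 = BitVec.ofNat w (S.length * Λ.L) ∧
  s 56 = BitVec.ofNat w (ones (sequenceBits S (Nat.clog 2 σ - Λ.L)) (S.length * Λ.L)) ∧
  s 53 = BitVec.ofNat w (2 ^ c / 2) ∧
  ∃ p, s 57 = BitVec.ofNat w p ∧ p ≤ markPosition S (Nat.clog 2 σ - Λ.L) r ∧
    markPosition S (Nat.clog 2 σ - Λ.L) r < p + 2 ^ c ∧ p + 2 ^ c ≤ 2 ^ (Λ.L + 1)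

/-- The interval of length `2 ^ (c + 1)` from `p` is cut at `p + 2 ^ c`; by `ones_marks_le_iff` the
mark lies in the upper half exactly when at most `r` marks precede the cut. Register 53 holds `2 ^ c
/ 2`, which becomes 0 at `c = 0` and so ends the loop. -/
theorem runs_searchStep (hw : 2 ≤ w) (hD : Represents D Λ S σ) (hM : D.length + 1 ≤ 2 ^ w)
    {r cnt c : ℕ} (hr : r < S.toFinset.card) {s : Registers w}
    (hs : SearchInvariant Λ S σ r cnt (c + 1) s) :
    Runs (memoryOf w D) searchStep s 500 (SearchInvariant Λ S σ r cnt c) := by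
  obtain ⟨hc, hcL, h1, h54, h55, h56, h53, p, h57, hp1, hp2, hp3⟩ := hs
  have hNlt := hD.ranks.N_lt
  have hnlt : S.length < 2 ^ w := by have := hD.header_le; omega
  have hrn : r < 2 ^ w := (hr.trans_le S.toFinset_card_le).trans hnlt
  have hhalf : 2 ^ (c + 1) / 2 = 2 ^ c := by rw [pow_succ]; omega
  have hdouble : 2 ^ (c + 1) = 2 ^ c + 2 ^ c := by rw [pow_succ]; omega
  rw [hhalf] at h53
  rw [hdouble] at hp2 hp3
  have h2w : 1 < 2 ^ w := Nat.one_lt_two_pow (by omega)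
  obtain ⟨l, hl⟩ : ∃ l, Nat.clog 2 σ - Λ.L = l := ⟨_, rfl⟩
  have hones : ones (sequenceBits S l) (S.length * Λ.L + (p + 2 ^ c)) =
      ones (sequenceBits S l) (S.length * Λ.L) +
        ones (marks (markPosition S l) S.toFinset.card) (p + 2 ^ c) := by
    have := ones_after_levels (S.map (denseRank S)) (rankWidth S)
      (marks (markPosition S l) S.toFinset.card) (p + 2 ^ c)
    rw [List.length_map, ← hD.levels] at this
    rw [sequenceBits, ← hD.levels]
    exact this
  have hiff := ones_marks_le_iff (markPosition_strictMono (S := S) l) hr (p + 2 ^ c)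
  have hle := ones_le (marks (markPosition S l) S.toFinset.card) (p + 2 ^ c)
  rw [hl] at hp1 hp2 h56
  generalize ones (marks (markPosition S l) S.toFinset.card) (p + 2 ^ c) = q at hones hiff hle
  obtain ⟨mem, hmem⟩ : ∃ mem, memoryOf w D = mem := ⟨_, rfl⟩
  obtain ⟨s₁, e₁⟩ : ∃ s₁, run mem [(58, .bin .add 57 53), (20, .bin .add 55 58)] s = s₁ :=
    ⟨_, rfl⟩
  have k₁ : ∀ r, r ≠ 58 → r ≠ 20 → s₁ r = s r := fun r h1 h2 => by rw [← e₁]; simp [run, h1, h2]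
  have v58 : s₁ 58 = BitVec.ofNat w (p + 2 ^ c) := by
    rw [BitVec.ofNat_add, ← h57, ← h53, ← e₁]
    simp [run, Operation.eval, BinOp.eval]
  have v20 : s₁ 20 = BitVec.ofNat w (S.length * Λ.L + (p + 2 ^ c)) := by
    rw [BitVec.ofNat_add, ← h55, ← v58, ← e₁]
    simp [run, Operation.eval, BinOp.eval]
  have c₁ := hc.congr (s' := s₁) fun r hr => k₁ r (by omega) (by omega)
  have v21 := rank_call hw hD hM c₁ (by omega) v20
  rw [hmem, hl] at v21
  obtain ⟨s₂, e₂⟩ : ∃ s₂, run mem [(59, .bin .sub 21 56)] (run mem rank s₁) = s₂ := ⟨_, rfl⟩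
  have k₂ : ∀ r, r < 10 ∨ 30 ≤ r → r ≠ 59 → s₂ r = s₁ r := fun r h1 h2 => by
    rw [← run_rank_frame (mem := mem) (s := s₁) h1, ← e₂]
    simp [run, h2]
  have k : ∀ r, r < 10 ∨ 30 ≤ r → r ≠ 58 → r ≠ 59 → s₂ r = s r := fun r h1 h2 h3 =>
    (k₂ r h1 h3).trans (k₁ r h2 (by omega))
  have c₂ := hc.congr (s' := s₂) fun r hr => k r (by omega) (by omega) (by omega)
  have w58 : s₂ 58 = BitVec.ofNat w (p + 2 ^ c) := (k₂ 58 (by simp) (by simp)).trans v58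
  have w59 : s₂ 59 = BitVec.ofNat w q := by
    rw [← Nat.add_sub_cancel_left (n := ones (sequenceBits S l) (S.length * Λ.L)) (m := q),
      ← hones, ← ofNat_sub (by omega), ← v21, ← h56, ← k₁ 56 (by simp) (by simp),
      ← run_rank_frame (mem := mem) (s := s₁) (r := 56) (by simp), ← e₂]
    simp [run, Operation.eval, BinOp.eval]
  have w54 := (k 54 (by simp) (by simp) (by simp)).trans h54
  have w55 := (k 55 (by simp) (by simp) (by simp)).trans h55
  have w56 := (k 56 (by simp) (by simp) (by simp)).trans h56
  have w57 := (k 57 (by simp) (by simp) (by simp)).trans h57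
  have w53 := (k 53 (by simp) (by simp) (by simp)).trans h53
  have w1 := (k 1 (by simp) (by simp) (by simp)).trans h1
  have htest : Test.Holds s₂ (.lt 54 59) ↔ ¬ p + 2 ^ c ≤ markPosition S l r := by
    change s₂ 54 < s₂ 59 ↔ _
    rw [w54, w59, ofNat_lt_ofNat hrn (by omega), ← hiff, not_le]
  have hshift : BitVec.ofNat w (2 ^ c) >>> BitVec.ofNat w 1 = BitVec.ofNat w (2 ^ c / 2) := by
    rw [ofNat_shr (by omega) h2w, pow_one]
  -- the registers before the shift
  let Q : Registers w → Prop := fun s' => (∀ r, r ≠ 57 → s' r = s₂ r) ∧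
    ∃ p, s' 57 = BitVec.ofNat w p ∧ p ≤ markPosition S l r ∧
      markPosition S l r < p + 2 ^ c ∧ p + 2 ^ c ≤ 2 ^ (Λ.L + 1)
  rw [hmem]
  have main : Runs mem searchStep s ((([(58, .bin .add 57 53), (20, .bin .add 55 58)] ++ rank ++
      [(59, .bin .sub 21 56)] : List (ℕ × Operation)).length + 1) + ((1 + 2) + 2))
      (SearchInvariant Λ S σ r cnt c) := by
    refine Runs.seq (runs_straight _ (Q := (· = s₂)) ?_) ?_
    · simp only [run_append, e₁, e₂]
    rintro _ rfl
    refine Runs.seq (Q₁ := Q) (Runs.ite (fun hb => ?_) (fun hb => ?_)) ?_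
    · refine Runs.mono (runs_straight [] (Q := Q) ⟨fun _ _ => rfl, p, w57, hp1, ?_, ?_⟩)
        (by simp) (fun _ h => h)
      · have := htest.1 hb; omega
      · omega
    · refine Runs.mono (runs_straight _ (Q := Q) ⟨fun r hr => by simp [run, hr], p + 2 ^ c, ?_,
        ?_, ?_, ?_⟩) (by simp) (fun _ h => h)
      · simp [run, Operation.eval, w58]
      · by_contra h; exact hb (htest.2 h)
      · omega
      · omega
    · rintro s₃ ⟨k₃, p', h57', hp1', hp2', hp3'⟩
      refine Runs.mono (runs_straight _ (Q := SearchInvariant Λ S σ r cnt c) ?_) (le_of_eq rfl)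
        (fun _ h => h)
      refine ⟨c₂.congr fun r hr => ?_, by omega, ?_⟩
      · have : r ≠ 53 ∧ r ≠ 57 := by omega
        simp [run, this, k₃ r this.2]
      · rw [hl]
        refine ⟨?_, ?_, ?_, ?_, ?_, p', ?_, hp1', hp2', hp3'⟩
        · simp [run, k₃, w1]
        · simp [run, k₃, w54]
        · simp [run, k₃, w55]
        · simp [run, k₃, w56]
        · rw [← hshift, ← w53, ← c₂.one]
          simp [run, k₃, Operation.eval, BinOp.eval]
        · simp [run, h57']
  exact main.mono (by simp [length_rank]) fun _ h => h

end Query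

/-! ### Correctness and running time of the whole query -/

theorem length_readHeaders (m : ℕ) : (readHeaders m).length = 21 * m := by
  induction m with
  | zero => rfl
  | succ m ih => simp [readHeaders, readHeader, fetch, readField, ih]; omega

theorem seqRange_map (S : List ℕ) (f : ℕ → ℕ) (i j : ℕ) :
    segment (S.map f) (i - 1) j = (seqRange S i j).map f := by
  rw [segment, seqRange, List.map_drop, List.map_take]

theorem mem_of_mem_seqRange {S : List ℕ} {i j x : ℕ} (h : x ∈ seqRange S i j) : x ∈ S :=
  List.mem_of_mem_take (List.mem_of_mem_drop h)

section Query
variable {w : ℕ} {D : List Bool} {Λ : Layout} {S : List ℕ} {σ : ℕ}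

/-- The descent ends with the dense rank of the answer. -/
theorem quantile_of_levelInvariant {i j k : ℕ} {s : Registers w}
    (h : LevelInvariant Λ S σ ((seqRange S i j).map (denseRank S)) (k - 1) 0 s) :
    ∃ lo hi r, r < S.toFinset.card ∧ lo ≤ hi ∧ hi ≤ S.length ∧
      rangeQuantile S i j k = some (distinctValue S r) ∧
      hi - lo = (seqRange S i j).count (distinctValue S r) ∧
      s 50 = BitVec.ofNat w lo ∧ s 51 = BitVec.ofNat w hi ∧ s 54 = BitVec.ofNat w r := by
  obtain ⟨-, -, lo, hi, k', r, hq, h50, h51, -, -, h54, -⟩ := h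
  have hlen := hq.le_length
  have hseg := hq.segment_eq
  have hrank := hq.rank_eq
  simp only [Nat.sub_zero, Nat.sub_self, pow_zero, mul_one, Nat.div_one] at hseg hrank
  have hcount : hi - lo = ((seqRange S i j).map (denseRank S)).count r := by
    rw [← length_segment (level (S.map (denseRank S)) Λ.L Λ.L)
      (by rw [length_level]; exact hlen), hseg, List.count,
      List.countP_eq_length_filter]
    congr 1
  obtain ⟨h1, h2, h3⟩ := quantile_of_denseRank (fun x hx => mem_of_mem_seqRange hx) hrank
    (hcount ▸ hq.lt)
  exact ⟨lo, hi, r, h1, hq.le, by simpa using hlen, h2, hcount.trans h3, h50, h51, h54⟩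

theorem levelInvariant_start (hw : 2 ≤ w) (hD : Represents D Λ S σ) (hM : D.length + 1 ≤ 2 ^ w)
    {i j k : ℕ} (hi : 1 ≤ i) (hij : i ≤ j) (hj : j ≤ S.length) (hk : 1 ≤ k)
    (hkj : k ≤ j - i + 1) :
    LevelInvariant Λ S σ ((seqRange S i j).map (denseRank S)) (k - 1) Λ.L
      (run (memoryOf w D) (readHeaders 13 ++ setup)
        (inputRegisters w [i, j, k, S.length, σ, Nat.clog 2 σ, w])) := by
  obtain ⟨s₀, e₀⟩ : ∃ s₀, inputRegisters w [i, j, k, S.length, σ, Nat.clog 2 σ, w] = s₀ :=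
    ⟨_, rfl⟩
  have i0 : s₀ 0 = BitVec.ofNat w i := by rw [← e₀]; rfl
  have i1 : s₀ 1 = BitVec.ofNat w j := by rw [← e₀]; rfl
  have i2 : s₀ 2 = BitVec.ofNat w k := by rw [← e₀]; rfl
  have i3 : s₀ 3 = BitVec.ofNat w S.length := by rw [← e₀]; rfl
  have i5 : s₀ 5 = BitVec.ofNat w (Nat.clog 2 σ) := by rw [← e₀]; rfl
  have i6 : s₀ 6 = BitVec.ofNat w w := by rw [← e₀]; rfl
  rw [e₀, run_append]
  obtain ⟨hh, hf⟩ := run_readHeaders hw hD hM (by omega) i3 i6 (m := 13) le_rfl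
  generalize run (memoryOf w D) (readHeaders 13) s₀ = s₁ at hh hf ⊢
  have h35 : s₁ 35 = BitVec.ofNat w Λ.L := hh 5 (by norm_num)
  have frame : ∀ r, r ≠ 60 → r ≠ 61 → (r < 50 ∨ 57 ≤ r) →
      run (memoryOf w D) setup s₁ r = s₁ r := by
    intro r h1 h2 h3
    have h : r ≠ 50 ∧ r ≠ 51 ∧ r ≠ 52 ∧ r ≠ 53 ∧ r ≠ 54 ∧ r ≠ 55 ∧ r ≠ 56 := by omega
    simp [setup, run, h1, h2, h]
  have hlen : (S.map (denseRank S)).length = S.length := List.length_map _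
  refine ⟨le_rfl, ⟨?_, ?_, ?_, ?_, ?_, ?_⟩, i - 1, j, k - 1, 0, ⟨by omega, ?_, by omega, ?_, ?_⟩,
    ?_, ?_, ?_, ?_, ?_, ?_, ?_⟩
  · rw [frame 3 (by simp) (by simp) (by simp), hf 3 (by simp), i3]
  · rw [frame 5 (by simp) (by simp) (by simp), hf 5 (by simp), i5]
  · rw [frame 6 (by simp) (by simp) (by simp), hf 6 (by simp), i6]
  · simp [setup, run, Operation.eval]
  · simp [setup, run, Operation.eval]
  · intro r hr
    rw [frame _ (by omega) (by omega) (by omega), hh r hr]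
  · rwa [hlen]
  · rw [Nat.sub_self, level, seqRange_map, List.filter_eq_self.2]
    intro x hx
    obtain ⟨y, hy, rfl⟩ := List.mem_map.1 hx
    have h1 := denseRank_lt (mem_of_mem_seqRange hy)
    have h2 : S.toFinset.card ≤ 2 ^ Λ.L := by
      rw [hD.levels]; exact Nat.le_pow_clog (by norm_num) _
    simpa using h1.trans_le h2
  · simp
  · rw [← ofNat_sub hi, ← i0, ← hf 0 (by simp)]
    simp [setup, run, Operation.eval, BinOp.eval]
  · rw [← i1, ← hf 1 (by simp)]
    simp [setup, run, Operation.eval]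
  · rw [← ofNat_sub hk, ← i2, ← hf 2 (by simp)]
    simp [setup, run, Operation.eval, BinOp.eval]
  · rw [← h35]
    simp [setup, run, Operation.eval]
  · simp [setup, run, Operation.eval]
  · simp [setup, run, Operation.eval]
  · simp [setup, run, Operation.eval, ones]

/-- Subtracting `r` from the mark position gives the high part. The low part is appended, and 1 is
added because the stored numbers are values minus one. -/
theorem run_output (hw : 2 ≤ w) (hD : Represents D Λ S σ) (hM : D.length + 1 ≤ 2 ^ w)
    (hσ : ∀ x ∈ S, 1 ≤ x ∧ x ≤ σ) (hσw : σ < 2 ^ w) {r cnt : ℕ} (hr : r < S.toFinset.card)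
    {s : Registers w} (hs : SearchInvariant Λ S σ r cnt 0 s) :
    run (memoryOf w D) output s 0 = BitVec.ofNat w (distinctValue S r) ∧
      run (memoryOf w D) output s 1 = BitVec.ofNat w cnt := by
  obtain ⟨hc, -, h1, h54, -, -, -, p, h57, hp1, hp2, -⟩ := hs
  obtain ⟨l, hl⟩ : ∃ l, Nat.clog 2 σ - Λ.L = l := ⟨_, rfl⟩
  rw [hl, pow_zero] at hp2
  rw [hl] at hp1
  -- With no rounds left the interval has length one, so `p` is the mark itself.
  have hp : p = (distinctValue S r - 1) / 2 ^ l + r := by unfold markPosition at hp1 hp2; omega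
  have hlow := hD.low r hr
  have hlowle := hD.low_le r hr
  rw [hl] at hlow hlowle
  have hlw : l < 2 ^ w := by
    have h1 : Nat.clog 2 σ ≤ w := (Nat.clog_le_iff_le_pow (by norm_num)).2 hσw.le
    have h2 : w < 2 ^ w := Nat.lt_two_pow_self
    omega
  have h35 : s 35 = BitVec.ofNat w Λ.L := hc.loaded 5 (by norm_num)
  have h42 : s 42 = BitVec.ofNat w Λ.aL := hc.loaded 12 (by norm_num)
  obtain ⟨s₁, e₁⟩ : ∃ s₁, run (memoryOf w D) [(58, .bin .sub 5 35), (57, .bin .sub 57 54)] s = s₁ :=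
    ⟨_, rfl⟩
  have k₁ : ∀ r, r ≠ 57 → r ≠ 58 → s₁ r = s r := fun r h1 h2 => by rw [← e₁]; simp [run, h1, h2]
  have v58 : s₁ 58 = BitVec.ofNat w l := by
    rw [← hl, ← ofNat_sub hD.levels_le, ← hc.width, ← h35, ← e₁]
    simp [run, Operation.eval, BinOp.eval]
  have v57 : s₁ 57 = BitVec.ofNat w ((distinctValue S r - 1) / 2 ^ l) := by
    rw [← Nat.add_sub_cancel (n := (distinctValue S r - 1) / 2 ^ l) (m := r), ← hp,
      ← ofNat_sub (hp ▸ Nat.le_add_left _ _), ← h57, ← h54, ← e₁]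
    simp [run, Operation.eval, BinOp.eval]
  have v12 := run_fetch (D := D) (s := s₁) (base := 42) (idx := 54) (wd := 58) hw
    ((k₁ 6 (by simp) (by simp)).trans hc.wordSize) (by norm_num) (by norm_num)
    ((k₁ 42 (by simp) (by simp)).trans h42) ((k₁ 54 (by simp) (by simp)).trans h54) v58
    (by omega) hlw
  rw [hlow] at v12
  have f : ∀ r, r < 10 ∨ 18 ≤ r → run (memoryOf w D) (fetch 42 54 58) s₁ r = s₁ r :=
    fun r hr => run_fetch_frame hr
  rw [output, run_append, run_append, e₁]
  generalize run (memoryOf w D) (fetch 42 54 58) s₁ = s₂ at v12 f ⊢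
  have w57 := (f 57 (by simp)).trans v57
  have w58 := (f 58 (by simp)).trans v58
  have w61 := (f 61 (by simp)).trans ((k₁ 61 (by simp) (by simp)).trans hc.one)
  have w1 := (f 1 (by simp)).trans ((k₁ 1 (by simp) (by simp)).trans h1)
  constructor
  · have hv := (hσ _ (distinctValue_mem hr)).1
    have hsum : distinctValue S r = (distinctValue S r - 1) / 2 ^ l * 2 ^ l +
        (distinctValue S r - 1) % 2 ^ l + 1 := by
      rw [Nat.div_add_mod']; omega
    conv_rhs => rw [hsum]
    rw [BitVec.ofNat_add, BitVec.ofNat_add, ← ofNat_shl hlw, ← w57, ← w58, ← v12, ← w61]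
    simp [run, Operation.eval, BinOp.eval]
  · rw [← w1]
    simp [run]

theorem runs_query (hw : 2 ≤ w) (hD : Represents D Λ S σ) (hM : D.length + 1 ≤ 2 ^ w)
    (hσ : ∀ x ∈ S, 1 ≤ x ∧ x ≤ σ) (hσw : σ < 2 ^ w)
    {i j k : ℕ} (hi : 1 ≤ i) (hij : i ≤ j) (hj : j ≤ S.length) (hk : 1 ≤ k)
    (hkj : k ≤ j - i + 1) :
    Runs (memoryOf w D) query (inputRegisters w [i, j, k, S.length, σ, Nat.clog 2 σ, w])
      (1002 * Λ.L + 1000)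
      (fun s => rangeQuantile S i j k = some (s 0).toNat ∧
        (s 1).toNat = (seqRange S i j).count (s 0).toNat) := by
  have hNlt := hD.ranks.N_lt
  have hnlt : S.length < 2 ^ w := by have := hD.header_le; omega
  have hpow : 2 ^ Λ.L < 2 ^ w := by rw [pow_succ] at hNlt; omega
  have hLlt : Λ.L < 2 ^ w := Nat.lt_two_pow_self.trans hpow
  have main : Runs (memoryOf w D) query
      (inputRegisters w [i, j, k, S.length, σ, Nat.clog 2 σ, w])
      (((readHeaders 13 ++ setup).length + 1) + ((Λ.L * (500 + 1) + 1) +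
        ((searchSetup.length + 1) + (((Λ.L + 1) * (500 + 1) + 1) + (output.length + 1)))))
      (fun s => rangeQuantile S i j k = some (s 0).toNat ∧
        (s 1).toNat = (seqRange S i j).count (s 0).toNat) := by
    refine Runs.seq (runs_straight _ (levelInvariant_start hw hD hM hi hij hj hk hkj)) ?_
    intro s₁ hs₁
    refine Runs.seq (Runs.loop (LevelInvariant Λ S σ _ (k - 1)) ?_ ?_
      (fun m s h => runs_levelStep hw hD hM h) Λ.L hs₁) ?_
    · rintro s ⟨-, hc, lo, hi, k, r, -, -, -, -, h53, -⟩
      change ¬ s 60 < s 53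
      rw [hc.zero, h53, ofNat_lt_ofNat (by positivity) (by positivity)]
      omega
    · rintro m s ⟨hm, hc, lo, hi, k, r, -, -, -, -, h53, -⟩
      change s 60 < s 53
      rw [hc.zero, h53, ofNat_lt_ofNat (by positivity) (by omega)]
      omega
    intro s₂ hs₂
    obtain ⟨lo, hi', r, hr, hlohi, hhi, hquant, hcount, h50, h51, h54⟩ :=
      quantile_of_levelInvariant hs₂
    obtain ⟨-, hc, lo', hi'', k', r', -, -, -, -, -, -, h55, h56⟩ := hs₂
    rw [Nat.sub_zero, mul_comm] at h55 h56
    have hmark := markPosition_lt hσ hD.levels hD.levels_le hr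
    refine Runs.seq (runs_straight _ (Q := SearchInvariant Λ S σ r (hi' - lo) (Λ.L + 1)) ?_) ?_
    · have h35 : s₂ 35 = BitVec.ofNat w Λ.L := hc.loaded 5 (by norm_num)
      -- The search starts with `p = 0` and `c = L + 1`, the whole universe of the marks.
      refine ⟨hc.congr fun r hr => ?_, le_rfl, ?_, ?_, ?_, ?_, ?_, 0, ?_, by omega, by omega,
        by omega⟩
      · have h : r ≠ 1 ∧ r ≠ 53 ∧ r ≠ 57 := by omega
        simp [searchSetup, run, h]
      · rw [← ofNat_sub hlohi, ← h50, ← h51]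
        simp [searchSetup, run, Operation.eval, BinOp.eval]
      · rw [← h54]
        simp [searchSetup, run]
      · rw [← h55]
        simp [searchSetup, run]
      · rw [← h56]
        simp [searchSetup, run]
      · rw [show 2 ^ (Λ.L + 1) / 2 = 1 * 2 ^ Λ.L by rw [pow_succ]; omega, ← ofNat_shl hLlt, ← h35,
          ← hc.one]
        simp [searchSetup, run, Operation.eval, BinOp.eval]
      · simp [searchSetup, run, Operation.eval]
    intro s₃ hs₃
    refine Runs.seq (Runs.loop (SearchInvariant Λ S σ r (hi' - lo)) ?_ ?_
      (fun m s h => runs_searchStep hw hD hM hr h) (Λ.L + 1) hs₃) ?_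
    · rintro s ⟨hc, -, -, -, -, -, h53, -⟩
      change ¬ s 60 < s 53
      rw [hc.zero, h53, ofNat_lt_ofNat (by positivity) (by simp)]
      simp
    · rintro m s ⟨hc, hm, -, -, -, -, h53, -⟩
      have h1 : 2 ^ (m + 1) / 2 = 2 ^ m := by rw [pow_succ]; omega
      have h2 : 2 ^ m ≤ 2 ^ Λ.L := Nat.pow_le_pow_right (by norm_num) (by omega)
      change s 60 < s 53
      rw [hc.zero, h53, h1, ofNat_lt_ofNat (by positivity) (by omega)]
      positivity
    intro s₄ hs₄
    refine runs_straight output ?_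
    obtain ⟨h0, h1⟩ := run_output hw hD hM hσ hσw hr hs₄
    have hv : distinctValue S r < 2 ^ w := ((hσ _ (distinctValue_mem hr)).2).trans_lt hσw
    rw [h0, h1, BitVec.toNat_ofNat, BitVec.toNat_ofNat, Nat.mod_eq_of_lt hv,
      Nat.mod_eq_of_lt (by omega)]
    exact ⟨hquant, hcount⟩
  refine main.mono ?_ fun _ h => h
  rw [List.length_append, length_readHeaders]
  simp only [setup, searchSetup, output, fetch, readField, List.length_append, List.length_cons,
    List.length_nil]
  omega

end Query

end RangeQuantile

open RangeQuantile in
theorem theorem1 :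
    ∃ (C : ℝ) (P : WordRAM.Program), 0 < C ∧
      ∀ (n σ : ℕ) (S : List ℕ), S.length = n → (∀ x ∈ S, 1 ≤ x ∧ x ≤ σ) →
        ∃ D : List Bool,
          (D.length : ℝ) ≤ n * Real.logb 2 σ + C * n ∧
          ∀ w : ℕ, σ < 2 ^ w → (n * Real.logb 2 σ + C * n : ℝ) ≤ 2 ^ w →
            ∀ i j k : ℕ, 1 ≤ i → i ≤ j → j ≤ n → 1 ≤ k → k ≤ j - i + 1 →
              ∃ (s : WordRAM.Registers w) (t : ℕ),
                WordRAM.Exec (WordRAM.memoryOf w D) P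
                  (WordRAM.inputRegisters w [i, j, k, n, σ, Nat.clog 2 σ, w]) s t ∧
                (t : ℝ) ≤ C * max 1 (Real.logb 2 (distinctValues S)) ∧
                rangeQuantile S i j k = some (s 0).toNat ∧
                (s 1).toNat = (seqRange S i j).count (s 0).toNat := by
  -- 4000 serves both purposes: the space needs 1400, and the time is at most `1002 * (log u + 1) +
  -- 1000 ≤ 3004 * max 1 (log u)`.
  refine ⟨4000, query, by norm_num, ?_⟩
  rintro n σ S rfl hσ
  rcases Nat.eq_zero_or_pos S.length with h0 | hS
  · refine ⟨[], by simp [h0], ?_⟩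
    intro w _ _ i j k hi hij hj
    omega
  obtain ⟨D, Λ, hD, hlen⟩ := exists_represents hS hσ
  have hS' : (1 : ℝ) ≤ S.length := by exact_mod_cast hS
  refine ⟨D, by linarith, ?_⟩
  intro w hσw hw i j k hi hij hj hk hkj
  have hM : D.length + 1 ≤ 2 ^ w := by
    have : ((D.length + 1 : ℕ) : ℝ) ≤ (2 ^ w : ℕ) := by push_cast; linarith
    exact_mod_cast this
  -- The header alone has `416 * n` bits, all of which must be addressable.
  have hw2 : 2 ≤ w := by
    by_contra h
    have h1 : 2 ^ w ≤ 2 ^ 1 := Nat.pow_le_pow_right (by norm_num) (by omega)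
    have h2 := hD.header_le
    omega
  obtain ⟨s, t, he, ht, hq⟩ := runs_query hw2 hD hM hσ hσw hi hij hj hk hkj
  refine ⟨s, t, he, ?_, hq⟩
  have hu : 1 ≤ S.toFinset.card := by
    obtain ⟨x, hx⟩ := List.exists_mem_of_length_pos hS
    exact Finset.card_pos.2 ⟨x, by simpa using hx⟩
  have hL := clog_le_logb_add_one hu
  have hΛ : Λ.L = Nat.clog 2 S.toFinset.card := hD.levels
  rw [← hΛ] at hL
  have ht' : (t : ℝ) ≤ 1002 * Λ.L + 1000 := by exact_mod_cast ht
  have m1 := le_max_left 1 (Real.logb 2 (distinctValues S))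
  have m2 := le_max_right 1 (Real.logb 2 (distinctValues S))
  rw [distinctValues] at *
  linarith
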